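/- Let $\mathbb N=\{1,2,\dots\}$. For $\varepsilon,\sigma>0$, a positive sequence $b=(b_j)_{j\in\mathbb N}$ and $\theta\in l^2(\mathbb N)$, let $\mathbb P_{\theta,b}$ (depending also on $\varepsilon,\sigma$) be the joint law of the observations $$Y_j=b_j\theta_j+\varepsilon\,\xi_j,\qquad X_j=b_j+\sigma\,\eta_j,\qquad j\in\mathbb N,$$ where all $\xi_j,\eta_j$ are independent standard Gaussian variables. Let $a=(a_j)$ be a non-decreasing sequence of positive reals with $a_j\to+\infty$, and put $\mathcal E_a=\{\theta\in l^2(\mathbb N):\sum_j a_j^2\theta_j^2\le 1\}$ and $\Theta_a(r)=\{\theta\in\mathcal E_a:\|\theta\|\ge r\}$. For constants $0<C_0\le 1\le C_1<\infty$ with $C_0<C_1$, let $\mathcal B(b)=\{\nu: C_0b_j\le\nu_j\le C_1b_j \text{ for all } j\}$, and let $\mathcal V$ be any set of sequences with $b\in\mathcal V\subseteq\mathcal B(b)$ (for instance $\mathcal V=\{b\}$ or $\mathcal V=\mathcal B(b)$). A test $\Psi$ assigns to each benchmark $\theta_0\in\mathcal E_a$, $\theta_0\ne0$, a measurable $\{0,1\}$-valued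 function $\Psi_{\theta_0}$ of $(Y,X)$; the value $1$ means that $\theta=\theta_0$ is rejected. Let $\alpha\in(0,1)$ and $\beta\in(0,1-\alpha)$. The test has level $\alpha$ if $\mathbb P_{\theta_0,\nu}(\Psi_{\theta_0}=1)\le\alpha$ for all such $\theta_0$ and all $\nu\in\mathcal B(b)$ (the singular values are unknown). Its separation radius $r_{\varepsilon,\sigma}(\Psi)$ is the infimum of the $r>0$ such that $$\sup\{\mathbb P_{\theta,\nu}(\Psi_{\theta_0}=0):\ 0\ne\theta_0\in\mathcal E_a,\ \theta-\theta_0\in\Theta_a(r),\ \nu\in\mathcal V\}\le\beta,$$ and the minimax separation radius $\tilde r_{\varepsilon,\sigma}$ is the infimum of $r_{\varepsilon,\sigma}(\Psi)$ over all tests $\Psi$ of level $\alpha$. Write $c_j\sim d_j$ if there are $0<\kappa_0\le\kappa_1<\infty$ with $\kappa_0\le c_j/d_j\le\kappa_1$ for all $j\in\mathbb N$. Let $s,t>0$. In each of the following four cases there exist $\varepsilon_0,\sigma_0\in(0,1)$ and a constant $\kappa>0$ (not depending on $\varepsilon,\sigma$) such that, for all $0<\varepsilon\le\varepsilon_0$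 and $0<\sigma\le\sigma_0$, $\tilde r_{\varepsilon,\sigma}^2\ge\kappa\,\rho_{\varepsilon,\sigma}$, where (i) if $b_j\sim j^{-t}$ and $a_j\sim j^s$: $\ \rho_{\varepsilon,\sigma}=\varepsilon^{\frac{4s}{2s+2t+1/2}}\vee\sigma^{2(\frac st\wedge1)}$; (ii) if $b_j\sim j^{-t}$ and $a_j\sim e^{js}$: $\ \rho_{\varepsilon,\sigma}=\varepsilon^2[\ln(1/\varepsilon)]^{2t+\frac12}\vee\sigma^2$; (iii) if $b_j\sim e^{-jt}$ and $a_j\sim j^s$: $\ \rho_{\varepsilon,\sigma}=[\ln(1/\varepsilon)]^{-2s}\vee[\ln(1/\sigma)]^{-2s}$; (iv) if $b_j\sim e^{-jt}$ and $a_j\sim e^{js}$: $\ \rho_{\varepsilon,\sigma}=\varepsilon^{\frac{2s}{s+t}}\vee\sigma^{2(\frac st\wedge1)}$. -/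

import Mathlib

open MeasureTheory ProbabilityTheory Filter

noncomputable section

namespace NoisyGSM

/-- The space `l²(ℕ)` of square-summable real sequences, with `ℕ = {1, 2, …}`. -/
abbrev Ell2 : Type := lp (fun _ : ℕ+ => ℝ) 2

/-- The observation space: pairs `(Y, X)` of real sequences. -/
abbrev Obs : Type := (ℕ+ → ℝ) × (ℕ+ → ℝ)

/-- The joint law `P_{θ,b}` of the observations `Y_j = b_j θ_j + ε ξ_j`, `X_j = b_j + σ η_j`,
where all the `ξ_j`, `η_j` are independent standard Gaussian variables. -/
def law (ε σ : ℝ) (θ : Ell2) (b : ℕ+ → ℝ) : Measure Obs :=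
  (Measure.infinitePi fun j : ℕ+ => gaussianReal (b j * θ j) (Real.toNNReal (ε ^ 2))).prod
    (Measure.infinitePi fun j : ℕ+ => gaussianReal (b j) (Real.toNNReal (σ ^ 2)))

/-- The ellipsoid `E_a = {θ ∈ l² : ∑ a_j² θ_j² ≤ 1}`. -/
def ellipsoid (a : ℕ+ → ℝ) : Set Ell2 :=
  {θ | Summable (fun j => a j ^ 2 * θ j ^ 2) ∧ ∑' j, a j ^ 2 * θ j ^ 2 ≤ 1}

/-- `Θ_a(r)`: the ellipsoid with the open `l²`-ball of radius `r` removed. -/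
def separatedSet (a : ℕ+ → ℝ) (r : ℝ) : Set Ell2 :=
  {θ | θ ∈ ellipsoid a ∧ r ≤ ‖θ‖}

/-- The sequences of singular values comparable to `b` with constants `C₀`, `C₁`. -/
def singularClass (b : ℕ+ → ℝ) (C₀ C₁ : ℝ) : Set (ℕ+ → ℝ) :=
  {ν | ∀ j, C₀ * b j ≤ ν j ∧ ν j ≤ C₁ * b j}

/-- The admissible benchmark signals: the nonzero elements of the ellipsoid. -/
def benchmarks (a : ℕ+ → ℝ) : Set Ell2 :=
  {θ₀ | θ₀ ∈ ellipsoid a ∧ θ₀ ≠ 0}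

/-- A non-randomized goodness-of-fit testing procedure: for each (known) benchmark `θ₀`, a
measurable `{0,1}`-valued function of the observation. The value `1` rejects `θ = θ₀`. The
procedure does not have access to the singular values. -/
structure Test where
  toFun : Ell2 → Obs → Fin 2
  measurable_toFun : ∀ θ₀, Measurable (toFun θ₀)

/-- `Ψ` is an `α`-level test: for every benchmark, the probability of rejecting it when it is the
true signal is at most `α`, whatever the unknown singular values in the class `𝓑`. -/
def IsLevelTest (a : ℕ+ → ℝ) (𝓑 : Set (ℕ+ → ℝ)) (α ε σ : ℝ) (Ψ : Test) : Prop :=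
  ∀ θ₀ ∈ benchmarks a, ∀ ν ∈ 𝓑, law ε σ θ₀ ν {z | Ψ.toFun θ₀ z = 1} ≤ ENNReal.ofReal α

/-- The maximal second kind error probability over benchmarks `θ₀`, signals `θ` with
`θ - θ₀ ∈ Θ_a(r)`, and singular values in `𝓥`. It is `0` if there are no such signals. -/
def secondKindError (a : ℕ+ → ℝ) (𝓥 : Set (ℕ+ → ℝ)) (ε σ r : ℝ) (Ψ : Test) : ENNReal :=
  ⨆ θ₀ ∈ benchmarks a, ⨆ θ ∈ {θ : Ell2 | θ - θ₀ ∈ separatedSet a r}, ⨆ ν ∈ 𝓥,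
    law ε σ θ ν {z | Ψ.toFun θ₀ z = 0}

/-- The separation radius of a test. -/
def separationRadius (a : ℕ+ → ℝ) (𝓥 : Set (ℕ+ → ℝ)) (β ε σ : ℝ) (Ψ : Test) : ℝ :=
  sInf {r : ℝ | 0 < r ∧ secondKindError a 𝓥 ε σ r Ψ ≤ ENNReal.ofReal β}

/-- The minimax separation radius: the infimum of the separation radii of the tests that have
level `α` for all singular values in `𝓑`, the second kind error being taken over `𝓥`. -/
def minimaxRadius (a : ℕ+ → ℝ) (𝓑 𝓥 : Set (ℕ+ → ℝ)) (α β ε σ : ℝ) : ℝ :=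
  sInf (separationRadius a 𝓥 β ε σ '' {Ψ | IsLevelTest a 𝓑 α ε σ Ψ})

/-- `c_j ∼ d_j`: the ratio lies between two positive constants, for all `j`. -/
def Comparable (c d : ℕ+ → ℝ) : Prop :=
  ∃ κ₀ κ₁ : ℝ, 0 < κ₀ ∧ κ₀ ≤ κ₁ ∧ ∀ j, κ₀ ≤ c j / d j ∧ c j / d j ≤ κ₁

/-- `f ≳ g` for small noise levels: there are `ε₀, σ₀ ∈ (0,1)` and `κ > 0` such that
`f ε σ ≥ κ g ε σ` for all `0 < ε ≤ ε₀` and `0 < σ ≤ σ₀`. -/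
def GtrsimSmallNoise (f g : ℝ → ℝ → ℝ) : Prop :=
  ∃ ε₀ ∈ Set.Ioo (0 : ℝ) 1, ∃ σ₀ ∈ Set.Ioo (0 : ℝ) 1, ∃ κ > 0,
    ∀ ε σ : ℝ, 0 < ε → ε ≤ ε₀ → 0 < σ → σ ≤ σ₀ → κ * g ε σ ≤ f ε σ

end NoisyGSM

end

noncomputable section

namespace NoisyGSM

open scoped NNReal ENNReal

/-! The proof is Le Cam's method. A level-`α` test accepts the null law with probability at least `1
- α`. If an alternative law, or a mixture of alternative laws, has a density with second moment at
most `1 + l ^ 2` with respect to the null law, then some alternative is accepted with probability at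
least `1 - α - l`, which exceeds `β` once `α + β + l < 1`. Two constructions produce the two terms
of each rate.

The `ε` term comes from symmetric sign priors with the singular values held at `b`
(`le_minimaxRadius_of_sign_prior`). Random signs on a finite block `s` of coordinates cancel the
first-order effect, so indistinguishability is governed by `∑ (b j * g j) ^ 4 / ε ^ 4`. The best `g`
gives the squared radius `ε ^ 2 * √(∑ (b j) ^ (-4))`, capped by `(a D) ^ (-2)` so that the signals
stay in the ellipsoid.

The `σ` term comes from confounding signal and operator
(`le_minimaxRadius_of_unknown_singular_value`). The pairs (signal `θ₀`, singular value `b j * (1 +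
x)`) and (signal `(1 + x) θ₀`, singular value `b j`), with `θ₀` supported at `j`, give `Y` the same
law; only `X j` separates them, by `x * b j` against noise `σ`. This yields the squared radius `min
(σ ^ 2 / b j ^ 2) 1 / a j ^ 2` up to a constant. The alternative always uses `b` itself, so the
bound holds even for `𝓥 = {b}`.

The four rates follow by choosing the block or the index `j` suitably in each regime. -/

/-! ### Likelihood ratios of Gaussian shifts and their second moments. -/

/-- The density of `N(m + h, v)` with respect to `N(m, v)`. -/
def shiftDensity (m : ℝ) (v : ℝ≥0) (h x : ℝ) : ℝ≥0∞ :=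
  ENNReal.ofReal (Real.exp (h * (x - m) / v - h ^ 2 / (2 * v)))

@[fun_prop]
lemma measurable_shiftDensity (m : ℝ) (v : ℝ≥0) (h : ℝ) : Measurable (shiftDensity m v h) := by
  unfold shiftDensity; fun_prop

lemma gaussianReal_add_eq_withDensity (m h : ℝ) {v : ℝ≥0} (hv : v ≠ 0) :
    gaussianReal (m + h) v = (gaussianReal m v).withDensity (shiftDensity m v h) := by
  rw [gaussianReal_of_var_ne_zero _ hv, gaussianReal_of_var_ne_zero _ hv,
    ← withDensity_mul _ (measurable_gaussianPDF _ _) (measurable_shiftDensity _ _ _)]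
  congr 1
  ext x
  have hv' : (v : ℝ) ≠ 0 := by exact_mod_cast hv
  simp only [gaussianPDF, shiftDensity, Pi.mul_apply, gaussianPDFReal]
  rw [← ENNReal.ofReal_mul (by positivity), mul_assoc (√(2 * Real.pi * (v : ℝ)))⁻¹, ← Real.exp_add]
  congr 3
  field_simp
  ring

lemma lintegral_shiftDensity (m h : ℝ) {v : ℝ≥0} (hv : v ≠ 0) :
    ∫⁻ x, shiftDensity m v h x ∂(gaussianReal m v) = 1 := by
  have h1 : gaussianReal (m + h) v Set.univ = 1 := measure_univ
  rwa [gaussianReal_add_eq_withDensity m h hv, withDensity_apply _ MeasurableSet.univ,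
    setLIntegral_univ] at h1

/-- Completing the square: `-(h ^ 2 + k ^ 2) / 2 = h * k - (h + k) ^ 2 / 2`. Hence the correlation
of two likelihood ratios is the exponential of the product of the shifts over `v`. -/
lemma shiftDensity_mul (m : ℝ) {v : ℝ≥0} (hv : v ≠ 0) (h k x : ℝ) :
    shiftDensity m v h x * shiftDensity m v k x =
      ENNReal.ofReal (Real.exp (h * k / v)) * shiftDensity m v (h + k) x := by
  have hv' : (v : ℝ) ≠ 0 := by exact_mod_cast hv
  simp only [shiftDensity]
  rw [← ENNReal.ofReal_mul (by positivity), ← ENNReal.ofReal_mul (by positivity), ← Real.exp_add,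
    ← Real.exp_add]
  congr 2
  field_simp
  ring

lemma lintegral_shiftDensity_mul (m : ℝ) {v : ℝ≥0} (hv : v ≠ 0) (h k : ℝ) :
    ∫⁻ x, shiftDensity m v h x * shiftDensity m v k x ∂(gaussianReal m v) =
      ENNReal.ofReal (Real.exp (h * k / v)) := by
  simp_rw [shiftDensity_mul m hv]
  rw [lintegral_const_mul _ (measurable_shiftDensity _ _ _), lintegral_shiftDensity _ _ hv, mul_one]

/-- The density of the even mixture of `N(m + h, v)` and `N(m - h, v)` with respect to
`N(m, v)`. -/
def mixDensity (m : ℝ) (v : ℝ≥0) (h x : ℝ) : ℝ≥0∞ :=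
  2⁻¹ * (shiftDensity m v h x + shiftDensity m v (-h) x)

@[fun_prop]
lemma measurable_mixDensity (m : ℝ) (v : ℝ≥0) (h : ℝ) : Measurable (mixDensity m v h) :=
  ((measurable_shiftDensity m v h).add (measurable_shiftDensity m v (-h))).const_mul _

lemma lintegral_mixDensity (m h : ℝ) {v : ℝ≥0} (hv : v ≠ 0) :
    ∫⁻ x, mixDensity m v h x ∂(gaussianReal m v) = 1 := by
  unfold mixDensity
  rw [lintegral_const_mul _ (by fun_prop),
    lintegral_add_left (measurable_shiftDensity _ _ _), lintegral_shiftDensity _ _ hv,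
    lintegral_shiftDensity _ _ hv, one_add_one_eq_two]
  exact ENNReal.inv_mul_cancel two_ne_zero ENNReal.ofNat_ne_top

/-- The four sign pairs contribute `exp (± h ^ 2 / v)` in equal numbers. Since `cosh x ≤ exp (x ^ 2
/ 2)`, symmetrization makes the cost quartic in `h`, whereas a single shift costs `exp (h ^ 2 / v)`.
-/
lemma lintegral_mixDensity_sq (m h : ℝ) {v : ℝ≥0} (hv : v ≠ 0) :
    ∫⁻ x, mixDensity m v h x ^ 2 ∂(gaussianReal m v) =
      ENNReal.ofReal (Real.cosh (h ^ 2 / v)) := by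
  have e : ∀ x, mixDensity m v h x ^ 2 =
      (2⁻¹ * 2⁻¹) * ((shiftDensity m v h x * shiftDensity m v h x +
          shiftDensity m v h x * shiftDensity m v (-h) x) +
        (shiftDensity m v (-h) x * shiftDensity m v h x +
          shiftDensity m v (-h) x * shiftDensity m v (-h) x)) := by
    intro x; unfold mixDensity; ring
  simp_rw [e]
  rw [lintegral_const_mul _ (by fun_prop), lintegral_add_left (by fun_prop),
    lintegral_add_left (by fun_prop), lintegral_add_left (by fun_prop)]
  simp_rw [lintegral_shiftDensity_mul m hv]
  have h2 : (2⁻¹ : ℝ≥0∞) = ENNReal.ofReal 2⁻¹ := by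
    rw [ENNReal.ofReal_inv_of_pos two_pos]; simp
  rw [h2, ← ENNReal.ofReal_mul (by positivity), ← ENNReal.ofReal_add (by positivity) (by positivity),
    ← ENNReal.ofReal_add (by positivity) (by positivity),
    ← ENNReal.ofReal_add (by positivity) (by positivity), ← ENNReal.ofReal_mul (by positivity)]
  congr 1
  rw [Real.cosh_eq]
  have e1 : h * h / (v : ℝ) = h ^ 2 / v := by ring
  have e2 : h * -h / (v : ℝ) = -(h ^ 2 / v) := by ring
  have e3 : -h * h / (v : ℝ) = -(h ^ 2 / v) := by ring
  have e4 : -h * -h / (v : ℝ) = h ^ 2 / v := by ring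
  rw [e1, e2, e3, e4]
  ring

/-! ### Finite changes of density in infinite product measures. -/

section InfinitePi

variable {ι : Type*} {X : ι → Type*} [∀ i, MeasurableSpace (X i)]

lemma lintegral_prod_infinitePi (μ : ∀ i, Measure (X i)) [∀ i, IsProbabilityMeasure (μ i)]
    (s : Finset ι) (f : ∀ i, X i → ℝ≥0∞) (hf : ∀ i, Measurable (f i)) :
    ∫⁻ x, ∏ i ∈ s, f i (x i) ∂(Measure.infinitePi μ) = ∏ i ∈ s, ∫⁻ x, f i x ∂(μ i) := by
  rw [lintegral_prod_eq_prod_lintegral_of_indepFun s (fun i (x : ∀ i, X i) => f i (x i))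
    (iIndepFun_infinitePi hf) (fun i => (hf i).comp (measurable_pi_apply i))]
  refine Finset.prod_congr rfl fun i _ => ?_
  rw [← (measurePreserving_eval_infinitePi μ i).lintegral_comp (hf i)]

/-- Changing finitely many factors of an infinite product measure to measures with densities. -/
theorem infinitePi_eq_withDensity (μ ν : ∀ i, Measure (X i)) [∀ i, IsProbabilityMeasure (μ i)]
    [∀ i, IsProbabilityMeasure (ν i)] (s : Finset ι) (f : ∀ i, X i → ℝ≥0∞)
    (hf : ∀ i, Measurable (f i)) (hs : ∀ i ∈ s, ν i = (μ i).withDensity (f i))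
    (hns : ∀ i ∉ s, ν i = μ i) :
    Measure.infinitePi ν = (Measure.infinitePi μ).withDensity (fun x => ∏ i ∈ s, f i (x i)) := by
  classical
  symm
  refine Measure.eq_infinitePi ν fun u t ht => ?_
  have hm : MeasurableSet (Set.pi (u : Set ι) t) :=
    MeasurableSet.pi u.countable_toSet fun i _ => ht i
  -- The indicator of the cylinder and the density are merged into one product over coordinates, so
  -- that the integral factorizes by independence.
  let g : ∀ i, X i → ℝ≥0∞ := fun i x =>
    (if i ∈ u then (t i).indicator 1 x else 1) * (if i ∈ s then f i x else 1)
  have hg : ∀ i, Measurable (g i) := fun i => by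
    refine Measurable.mul ?_ ?_
    · split_ifs
      · exact measurable_one.indicator (ht i)
      · exact measurable_const
    · split_ifs
      · exact hf i
      · exact measurable_const
  have e : (Set.pi (u : Set ι) t).indicator (fun x => ∏ i ∈ s, f i (x i)) =
      fun x => ∏ i ∈ u ∪ s, g i (x i) := by
    ext x
    have e1 : ∏ i ∈ u ∪ s, (if i ∈ s then f i (x i) else 1) = ∏ i ∈ s, f i (x i) := by
      rw [Finset.prod_ite_mem, Finset.union_inter_cancel_right]
    have e2 : ∏ i ∈ u ∪ s, (if i ∈ u then (t i).indicator (1 : X i → ℝ≥0∞) (x i) else 1) =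
        (Set.pi (u : Set ι) t).indicator 1 x := by
      rw [Finset.prod_ite_mem, Finset.union_inter_cancel_left]
      by_cases hx : x ∈ Set.pi (u : Set ι) t
      · rw [Set.indicator_of_mem hx]
        exact Finset.prod_eq_one fun i hi => by rw [Set.indicator_of_mem (hx i hi)]; rfl
      · rw [Set.indicator_of_notMem hx]
        simp only [Set.mem_pi, not_forall] at hx
        obtain ⟨i, hi, hx⟩ := hx
        exact Finset.prod_eq_zero hi (Set.indicator_of_notMem hx _)
    simp only [g]
    rw [Finset.prod_mul_distrib, e1, e2]
    by_cases hx : x ∈ Set.pi (u : Set ι) t <;> simp [hx]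
  rw [withDensity_apply _ hm, ← lintegral_indicator hm, e, lintegral_prod_infinitePi μ _ g hg]
  have e3 : ∀ i ∈ u ∪ s, ∫⁻ x, g i x ∂(μ i) = if i ∈ u then ν i (t i) else 1 := by
    intro i _
    have e4 : ∫⁻ x, g i x ∂(μ i) = ∫⁻ x, (if i ∈ u then (t i).indicator 1 x else 1) ∂(ν i) := by
      by_cases his : i ∈ s
      · rw [hs i his, lintegral_withDensity_eq_lintegral_mul _ (hf i)]
        · simp [g, his, mul_comm]
        · split_ifs
          · exact measurable_one.indicator (ht i)
          · exact measurable_const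
      · rw [hns i his]; simp [g, his]
    rw [e4]
    split_ifs
    · rw [lintegral_indicator_one (ht i)]
    · simp
  rw [Finset.prod_congr rfl e3, Finset.prod_ite_mem, Finset.union_inter_cancel_left]

end InfinitePi

/-! ### Second-moment comparison of measures. -/

section ChiSquare

variable {Ω : Type*} [MeasurableSpace Ω]

/-- A probability measure whose density has second moment at most `1 + l²` loses at most `l` on
each event. -/
lemma measure_le_setLIntegral_add (P : Measure Ω) [IsProbabilityMeasure P] {G : Ω → ℝ≥0∞}
    (hG : Measurable G) (hG1 : ∫⁻ x, G x ∂P = 1) {l : ℝ} (hl : 0 < l)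
    (hG2 : ∫⁻ x, G x ^ 2 ∂P ≤ ENNReal.ofReal (1 + l ^ 2)) {A : Set Ω} (hA : MeasurableSet A) :
    P A ≤ ∫⁻ x in A, G x ∂P + ENNReal.ofReal l := by
  set L := ENNReal.ofReal l with hL
  have hQ : ∫⁻ x in A, G x ∂P ≤ 1 := hG1 ▸ setLIntegral_le_lintegral _ _
  have hP : P A ≤ 1 := prob_le_one
  -- On `A` the difference of the two sides is `(L + G - 1) ^ 2`; off `A` it is `(G - 1) ^ 2 + L ^
  -- 2`. Integrating gives `2 L P(A) + 2 ≤ 2 L Q(A) + 2 + 2 L ^ 2`, where `Q` has density `G`. This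
  -- replaces Cauchy–Schwarz and avoids subtraction in `ℝ≥0∞`.
  have key : ∀ x, 2 * L * A.indicator 1 x + 2 * G x ≤
      2 * L * A.indicator G x + (L ^ 2 + 1 + G x ^ 2) := by
    intro x
    by_cases hx : G x = ⊤
    · simp [hx]
    obtain ⟨g, hg⟩ : ∃ g : ℝ≥0, G x = g := ⟨(G x).toNNReal, (ENNReal.coe_toNNReal hx).symm⟩
    have hL' : L = (l.toNNReal : ℝ≥0∞) := rfl
    generalize l.toNNReal = k at hL'
    by_cases hxA : x ∈ A
    · simp only [Set.indicator_of_mem hxA, hg, hL', Pi.one_apply]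
      norm_cast
      rw [← NNReal.coe_le_coe]
      push_cast
      nlinarith [sq_nonneg ((k : ℝ) + g - 1)]
    · simp only [Set.indicator_of_notMem hxA, hg, hL']
      norm_cast
      rw [← NNReal.coe_le_coe]
      push_cast
      nlinarith [sq_nonneg ((g : ℝ) - 1), sq_nonneg (k : ℝ)]
  have int := lintegral_mono (μ := P) key
  have m1 : Measurable (fun x => 2 * L * A.indicator (1 : Ω → ℝ≥0∞) x) :=
    (measurable_one.indicator hA).const_mul _
  have m2 : Measurable (fun x => 2 * L * A.indicator G x) := (hG.indicator hA).const_mul _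
  rw [lintegral_add_left m1, lintegral_add_left m2, lintegral_const_mul _ hG,
    lintegral_const_mul _ (measurable_one.indicator hA), lintegral_const_mul _ (hG.indicator hA),
    lintegral_add_left measurable_const, lintegral_const, measure_univ, hG1,
    lintegral_indicator_one hA, lintegral_indicator hA] at int
  have int2 : 2 * L * P A + 2 * 1 ≤
      2 * L * ∫⁻ x in A, G x ∂P + ((L ^ 2 + 1) * 1 + ENNReal.ofReal (1 + l ^ 2)) :=
    int.trans (by gcongr)
  obtain ⟨p, hp⟩ : ∃ p : ℝ≥0, P A = p :=
    ⟨(P A).toNNReal, (ENNReal.coe_toNNReal (ne_top_of_le_ne_top ENNReal.one_ne_top hP)).symm⟩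
  obtain ⟨q, hq⟩ : ∃ q : ℝ≥0, ∫⁻ x in A, G x ∂P = q :=
    ⟨(∫⁻ x in A, G x ∂P).toNNReal,
      (ENNReal.coe_toNNReal (ne_top_of_le_ne_top ENNReal.one_ne_top hQ)).symm⟩
  lift l to ℝ≥0 using hl.le
  have h1 : ENNReal.ofReal (1 + (l : ℝ) ^ 2) = ((1 + l ^ 2 : ℝ≥0) : ℝ≥0∞) := by
    rw [← ENNReal.ofReal_coe_nnreal]; norm_cast
  rw [ENNReal.ofReal_coe_nnreal] at hL
  rw [hp, hq, hL, h1] at int2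
  rw [hp, hq, hL]
  norm_cast at int2 ⊢
  rw [← NNReal.coe_le_coe] at int2 ⊢
  push_cast at int2 ⊢
  have hl' : (0 : ℝ) < l := hl
  by_contra hlt
  push Not at hlt
  nlinarith [mul_lt_mul_of_pos_left hlt hl']

/-- The second-moment method against a finite mixture: some component of the mixture is hard to
distinguish from `P`. -/
lemma exists_measure_le_add {κ : Type*} (P : Measure Ω) [IsProbabilityMeasure P] (T : Finset κ)
    (hT : T.Nonempty) (Q : κ → Measure Ω) (F : κ → Ω → ℝ≥0∞) (hF : ∀ i, Measurable (F i))
    (hQ : ∀ i, Q i = P.withDensity (F i)) {G : Ω → ℝ≥0∞} (hG : Measurable G)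
    (hFG : ∀ x, ∑ i ∈ T, F i x = T.card * G x) (hG1 : ∫⁻ x, G x ∂P = 1) {l : ℝ} (hl : 0 < l)
    (hG2 : ∫⁻ x, G x ^ 2 ∂P ≤ ENNReal.ofReal (1 + l ^ 2)) {A : Set Ω} (hA : MeasurableSet A) :
    ∃ i ∈ T, P A ≤ Q i A + ENNReal.ofReal l := by
  -- The component giving `A` the largest mass dominates the mixture, whose density is `G`.
  obtain ⟨i, hi, hmax⟩ := T.exists_max_image (fun i => Q i A) hT
  refine ⟨i, hi, (measure_le_setLIntegral_add P hG hG1 hl hG2 hA).trans ?_⟩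
  gcongr
  have h1 : (T.card : ℝ≥0∞) * ∫⁻ x in A, G x ∂P ≤ T.card * Q i A := by
    calc (T.card : ℝ≥0∞) * ∫⁻ x in A, G x ∂P = ∑ k ∈ T, Q k A := by
          rw [← lintegral_const_mul _ hG]
          simp_rw [← hFG]
          rw [lintegral_finsetSum _ fun k _ => hF k]
          exact Finset.sum_congr rfl fun k _ => by rw [hQ k, withDensity_apply _ hA]
      _ ≤ ∑ _k ∈ T, Q i A := Finset.sum_le_sum hmax
      _ = T.card * Q i A := by simp
  rwa [ENNReal.mul_le_mul_iff_right (by simpa using hT.ne_empty) (ENNReal.natCast_ne_top _)] at h1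

end ChiSquare

/-! ### Indistinguishable perturbations of a Gaussian sequence. -/

section GaussianSequence

variable {ι : Type*} {Ω : Type*} [MeasurableSpace Ω]

/-- Symmetric two-point priors on finitely many coordinates of a Gaussian sequence. -/
theorem exists_sign_measure_le_add [DecidableEq ι] (m h : ι → ℝ) {v : ℝ≥0} (hv : v ≠ 0)
    (s : Finset ι) {l : ℝ} (hl : 0 < l) (hh : ∑ j ∈ s, h j ^ 4 / (2 * v ^ 2) ≤ Real.log (1 + l ^ 2))
    (R : Measure Ω) [IsProbabilityMeasure R] {A : Set ((ι → ℝ) × Ω)} (hA : MeasurableSet A) :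
    ∃ t : Finset ι, (Measure.infinitePi fun j => gaussianReal (m j) v).prod R A ≤
      (Measure.infinitePi fun j =>
        gaussianReal (m j + if j ∈ s then (if j ∈ t then h j else -h j) else 0) v).prod R A +
        ENNReal.ofReal l := by
  let P := Measure.infinitePi fun j => gaussianReal (m j) v
  let d : Finset ι → ∀ _ : ι, ℝ → ℝ≥0∞ := fun t j =>
    shiftDensity (m j) v (if j ∈ t then h j else -h j)
  have hd : ∀ t j, Measurable (d t j) := fun t j => measurable_shiftDensity _ _ _
  have hF : ∀ t, Measurable fun y : ι → ℝ => ∏ j ∈ s, d t j (y j) := fun t =>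
    Finset.measurable_prod _ fun j _ => (hd t j).comp (measurable_pi_apply j)
  have hG : Measurable fun y : ι → ℝ => ∏ j ∈ s, mixDensity (m j) v (h j) (y j) :=
    Finset.measurable_prod _ fun j _ => (measurable_mixDensity _ _ _).comp (measurable_pi_apply j)
  have hP : ∀ {f : (ι → ℝ) → ℝ≥0∞}, Measurable f →
      ∫⁻ z, f z.1 ∂(P.prod R) = ∫⁻ y, f y ∂P := fun {f} hf => by
    rw [lintegral_prod (fun z => f z.1) (hf.comp measurable_fst).aemeasurable]
    simp
  refine Exists.imp (fun t ht => ht.2) (exists_measure_le_add (P.prod R) s.powerset ⟨∅, by simp⟩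
    (fun t => (Measure.infinitePi fun j =>
      gaussianReal (m j + if j ∈ s then (if j ∈ t then h j else -h j) else 0) v).prod R)
    (fun t z => ∏ j ∈ s, d t j (z.1 j)) (fun t => (hF t).comp measurable_fst) (fun t => ?_)
    (G := fun z => ∏ j ∈ s, mixDensity (m j) v (h j) (z.1 j)) (hG.comp measurable_fst)
    (fun z => ?_) ?_ hl ?_ hA)
  · rw [infinitePi_eq_withDensity (fun j => gaussianReal (m j) v) _ s (d t) (hd t),
      prod_withDensity_left (hF t)]
    · intro j hj
      simp only [hj, if_true]
      exact gaussianReal_add_eq_withDensity _ _ hv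
    · intro j hj
      simp [hj]
  -- The product of the two-term mixtures expands into a sum over the subsets `t` of plus signs, and
  -- the `2 ^ s.card` patterns cancel the factors `2⁻¹`.
  · simp only [mixDensity, d]
    rw [Finset.prod_mul_distrib, Finset.prod_add, Finset.prod_const, Finset.card_powerset,
      ← mul_assoc]
    have : ((2 ^ s.card : ℕ) : ℝ≥0∞) * 2⁻¹ ^ s.card = 1 := by
      push_cast
      rw [← mul_pow, ENNReal.mul_inv_cancel two_ne_zero ENNReal.ofNat_ne_top, one_pow]
    rw [this, one_mul]
    refine Finset.sum_congr rfl fun t ht => ?_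
    rw [Finset.mem_powerset] at ht
    rw [← Finset.prod_sdiff ht, mul_comm]
    congr 1
    · exact Finset.prod_congr rfl fun j hj => by rw [if_pos hj]
    · exact Finset.prod_congr rfl fun j hj => by rw [if_neg (Finset.mem_sdiff.1 hj).2]
  · rw [hP hG, lintegral_prod_infinitePi _ s (fun j => mixDensity (m j) v (h j))
      fun j => measurable_mixDensity _ _ _]
    exact Finset.prod_eq_one fun j _ => lintegral_mixDensity _ _ hv
  · rw [hP (f := fun y => (∏ j ∈ s, mixDensity (m j) v (h j) (y j)) ^ 2) (hG.pow_const 2)]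
    simp_rw [← Finset.prod_pow]
    rw [lintegral_prod_infinitePi _ s (fun j x => mixDensity (m j) v (h j) x ^ 2)
      fun j => (measurable_mixDensity _ _ _).pow_const 2]
    simp_rw [lintegral_mixDensity_sq _ _ hv]
    rw [← ENNReal.ofReal_prod_of_nonneg fun j _ => (Real.cosh_pos _).le]
    refine ENNReal.ofReal_le_ofReal ?_
    calc ∏ j ∈ s, Real.cosh (h j ^ 2 / v)
        ≤ ∏ j ∈ s, Real.exp (h j ^ 4 / (2 * v ^ 2)) := by
          refine Finset.prod_le_prod (fun j _ => (Real.cosh_pos _).le) fun j _ => ?_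
          refine (Real.cosh_le_exp_half_sq _).trans (le_of_eq ?_)
          congr 1
          rw [div_pow, div_div, mul_comm _ (2 : ℝ)]
          ring
      _ = Real.exp (∑ j ∈ s, h j ^ 4 / (2 * v ^ 2)) := (Real.exp_sum _ _).symm
      _ ≤ 1 + l ^ 2 := by
          rw [← Real.le_log_iff_exp_le (by positivity)]
          exact hh

/-- Shifting one coordinate of a Gaussian sequence. -/
theorem shift_measure_le_add (m m' : ι → ℝ) {v : ℝ≥0} (hv : v ≠ 0) (j : ι)
    (hm : ∀ i ≠ j, m' i = m i) {l : ℝ} (hl : 0 < l)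
    (hh : (m' j - m j) ^ 2 / v ≤ Real.log (1 + l ^ 2))
    (R : Measure Ω) [IsProbabilityMeasure R] {A : Set (Ω × (ι → ℝ))} (hA : MeasurableSet A) :
    R.prod (Measure.infinitePi fun j => gaussianReal (m j) v) A ≤
      R.prod (Measure.infinitePi fun j => gaussianReal (m' j) v) A + ENNReal.ofReal l := by
  let P := Measure.infinitePi fun j => gaussianReal (m j) v
  let d : ∀ _ : ι, ℝ → ℝ≥0∞ := fun i => shiftDensity (m i) v (m' i - m i)
  have hd : ∀ j, Measurable (d j) := fun j => measurable_shiftDensity _ _ _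
  have hF : Measurable fun y : ι → ℝ => ∏ i ∈ {j}, d i (y i) :=
    Finset.measurable_prod _ fun j _ => (hd j).comp (measurable_pi_apply j)
  have hP : ∀ {f : (ι → ℝ) → ℝ≥0∞}, Measurable f →
      ∫⁻ z, f z.2 ∂(R.prod P) = ∫⁻ y, f y ∂P := fun {f} hf => by
    rw [lintegral_prod (fun z => f z.2) (hf.comp measurable_snd).aemeasurable]
    simp
  have hQ : R.prod (Measure.infinitePi fun j => gaussianReal (m' j) v) A =
      ∫⁻ z in A, ∏ i ∈ {j}, d i (z.2 i) ∂(R.prod P) := by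
    rw [infinitePi_eq_withDensity (fun j => gaussianReal (m j) v) _ {j} d hd,
      prod_withDensity_right hF, withDensity_apply _ hA]
    · intro i _
      simp only [d]
      rw [← gaussianReal_add_eq_withDensity _ _ hv]
      congr 1
      ring
    · intro i hi
      rw [hm i (by simpa using hi)]
  rw [hQ]
  refine measure_le_setLIntegral_add (R.prod P) (hF.comp measurable_snd) ?_ hl ?_ hA
  · refine (hP hF).trans ?_
    rw [lintegral_prod_infinitePi _ {j} d hd]
    exact Finset.prod_eq_one fun j _ => lintegral_shiftDensity _ _ hv
  · refine (hP (f := fun y => (∏ i ∈ {j}, d i (y i)) ^ 2) (hF.pow_const 2)).le.trans ?_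
    simp_rw [← Finset.prod_pow]
    rw [lintegral_prod_infinitePi _ {j} (fun j x => d j x ^ 2) fun j => (hd j).pow_const 2]
    simp only [Finset.prod_singleton, d, sq (shiftDensity _ _ _ _)]
    rw [lintegral_shiftDensity_mul _ hv, ← sq]
    refine ENNReal.ofReal_le_ofReal ?_
    rwa [← Real.le_log_iff_exp_le (by positivity)]

end GaussianSequence

instance (ε σ : ℝ) (θ : Ell2) (b : ℕ+ → ℝ) : IsProbabilityMeasure (law ε σ θ b) := by
  unfold law; infer_instance

/-! ### From indistinguishability to the separation radius. -/

section Radius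

variable {a : ℕ+ → ℝ} {𝓑 𝓥 : Set (ℕ+ → ℝ)} {α β ε σ : ℝ}

lemma measurableSet_accept (Ψ : Test) (θ₀ : Ell2) : MeasurableSet {z | Ψ.toFun θ₀ z = 0} :=
  Ψ.measurable_toFun θ₀ (measurableSet_singleton 0)

lemma norm_sq_eq_tsum (θ : Ell2) : ‖θ‖ ^ 2 = ∑' j, θ j ^ 2 := by
  have := lp.norm_rpow_eq_tsum (p := 2) (by norm_num) θ
  simpa using this

lemma summable_sq (θ : Ell2) : Summable fun j => θ j ^ 2 := by
  have := (lp.memℓp θ).summable (p := 2) (by norm_num)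
  simpa using this

lemma mul_norm_le_of_mem_ellipsoid (ha_pos : ∀ j, 0 < a j) (ha_mono : Monotone a) {θ : Ell2}
    (hθ : θ ∈ ellipsoid a) : a 1 * ‖θ‖ ≤ 1 := by
  obtain ⟨h1, h2⟩ := hθ
  have h3 : a 1 ^ 2 * ‖θ‖ ^ 2 ≤ 1 := by
    rw [norm_sq_eq_tsum, ← tsum_mul_left]
    refine le_trans (((summable_sq θ).mul_left _).tsum_le_tsum (fun j => ?_) h1) h2
    have : a 1 ≤ a j := ha_mono one_le
    have := (ha_pos 1).le
    gcongr
  rw [← mul_pow] at h3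
  exact (sq_le_one_iff₀ (mul_nonneg (ha_pos 1).le (norm_nonneg _))).1 h3

/-- The ellipsoid has radius at most `1 / a 1`, so at `2 / a 1` there are no alternatives and the
error is `0`. This keeps the infimum defining the separation radius from being over the empty set,
where `sInf` would be `0`. -/
lemma exists_secondKindError_le (ha_pos : ∀ j, 0 < a j) (ha_mono : Monotone a) (Ψ : Test) :
    ∃ r, 0 < r ∧ secondKindError a 𝓥 ε σ r Ψ ≤ ENNReal.ofReal β := by
  have h1 := ha_pos 1
  refine ⟨2 / a 1, by positivity, ?_⟩
  simp only [secondKindError, iSup_le_iff]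
  rintro θ₀ - θ ⟨hθ, hr⟩
  have h2 := mul_norm_le_of_mem_ellipsoid ha_pos ha_mono hθ
  rw [div_le_iff₀ h1] at hr
  linarith [mul_comm (a 1) ‖θ - θ₀‖]

lemma le_minimaxRadius (ha_pos : ∀ j, 0 < a j) (ha_mono : Monotone a) {c : ℝ}
    (h : ∀ Ψ, IsLevelTest a 𝓑 α ε σ Ψ → ∀ r, r ≤ c →
      ENNReal.ofReal β < secondKindError a 𝓥 ε σ r Ψ) :
    c ≤ minimaxRadius a 𝓑 𝓥 α β ε σ := by
  refine le_csInf ?_ ?_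
  -- The test that always accepts has level `α`, so the infimum is over a nonempty set.
  · refine ⟨_, ⟨fun _ _ => 0, fun _ => measurable_const⟩, ?_, rfl⟩
    intro θ₀ _ ν _
    simp
  · rintro _ ⟨Ψ, hΨ, rfl⟩
    refine le_csInf (exists_secondKindError_le ha_pos ha_mono Ψ) ?_
    rintro r ⟨-, hr⟩
    by_contra hlt
    exact absurd hr (not_le.2 (h Ψ hΨ r (not_le.1 hlt).le))

/-- If the law under the null is hardly distinguishable from a law under the alternative on the
acceptance region, the second kind error is large. -/
lemma lt_secondKindError {Ψ : Test} (hΨ : IsLevelTest a 𝓑 α ε σ Ψ) (hα : 0 ≤ α) (hβ : 0 ≤ β)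
    {l : ℝ} (hl : 0 ≤ l) (hlt : α + β + l < 1) {θ₀ θ : Ell2} (hθ₀ : θ₀ ∈ benchmarks a)
    {ν₀ ν : ℕ+ → ℝ} (hν₀ : ν₀ ∈ 𝓑) (hν : ν ∈ 𝓥) {r : ℝ} (hθ : θ - θ₀ ∈ separatedSet a r)
    (H : law ε σ θ₀ ν₀ {z | Ψ.toFun θ₀ z = 0} ≤
      law ε σ θ ν {z | Ψ.toFun θ₀ z = 0} + ENNReal.ofReal l) :
    ENNReal.ofReal β < secondKindError a 𝓥 ε σ r Ψ := by
  by_contra hle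
  rw [not_lt] at hle
  have h1 : law ε σ θ ν {z | Ψ.toFun θ₀ z = 0} ≤ ENNReal.ofReal β := by
    refine le_trans ?_ hle
    exact le_iSup₂_of_le θ₀ hθ₀ (le_iSup₂_of_le θ hθ (le_iSup₂_of_le ν hν le_rfl))
  have hc : {z | Ψ.toFun θ₀ z = 0}ᶜ = {z | Ψ.toFun θ₀ z = 1} := by
    ext z
    simp only [Set.mem_compl_iff, Set.mem_ofPred_eq]
    generalize Ψ.toFun θ₀ z = x
    fin_cases x <;> simp
  have h2 := hΨ θ₀ hθ₀ ν₀ hν₀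
  rw [← hc] at h2
  have h3 : (1 : ℝ≥0∞) ≤ ENNReal.ofReal (β + l + α) := by
    calc (1 : ℝ≥0∞) = law ε σ θ₀ ν₀ {z | Ψ.toFun θ₀ z = 0} +
          law ε σ θ₀ ν₀ {z | Ψ.toFun θ₀ z = 0}ᶜ :=
          (prob_add_prob_compl (measurableSet_accept Ψ θ₀)).symm
      _ ≤ (ENNReal.ofReal β + ENNReal.ofReal l) + ENNReal.ofReal α := by
          gcongr
          exact H.trans (by gcongr)
      _ = ENNReal.ofReal (β + l + α) := by
          rw [ENNReal.ofReal_add (by positivity) hα, ENNReal.ofReal_add hβ hl]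
  rw [ENNReal.one_le_ofReal] at h3
  linarith

end Radius

/-! ### Signals with finite support. -/

section FiniteSignals

/-- The signal with coordinates `g j` for `j ∈ s` and `0` elsewhere. -/
def finiteSignal (s : Finset ℕ+) (g : ℕ+ → ℝ) : Ell2 := ∑ j ∈ s, lp.single 2 j (g j)

lemma finiteSignal_apply (s : Finset ℕ+) (g : ℕ+ → ℝ) (k : ℕ+) :
    finiteSignal s g k = if k ∈ s then g k else 0 := by
  unfold finiteSignal
  rw [lp.coeFn_sum, Finset.sum_apply]
  simp [Pi.single_apply]

lemma norm_sq_finiteSignal (s : Finset ℕ+) (g : ℕ+ → ℝ) :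
    ‖finiteSignal s g‖ ^ 2 = ∑ j ∈ s, g j ^ 2 := by
  rw [norm_sq_eq_tsum, tsum_eq_sum (s := s)]
  · exact Finset.sum_congr rfl fun j hj => by rw [finiteSignal_apply, if_pos hj]
  · intro j hj
    rw [finiteSignal_apply, if_neg hj]
    simp

lemma finiteSignal_mem_ellipsoid {a : ℕ+ → ℝ} {s : Finset ℕ+} {g : ℕ+ → ℝ}
    (h : ∑ j ∈ s, a j ^ 2 * g j ^ 2 ≤ 1) : finiteSignal s g ∈ ellipsoid a := by
  have h0 : ∀ j ∉ s, a j ^ 2 * finiteSignal s g j ^ 2 = 0 := fun j hj => by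
    rw [finiteSignal_apply, if_neg hj]; simp
  refine ⟨summable_of_ne_finset_zero (s := s) h0, ?_⟩
  rw [tsum_eq_sum h0]
  refine le_of_eq_of_le (Finset.sum_congr rfl fun j hj => ?_) h
  rw [finiteSignal_apply, if_pos hj]

lemma finiteSignal_singleton_mem_benchmarks {a : ℕ+ → ℝ} (ha_pos : ∀ j, 0 < a j) (j : ℕ+) :
    finiteSignal {j} (fun j => (a j)⁻¹) ∈ benchmarks a := by
  have := (ha_pos j).ne'
  refine ⟨finiteSignal_mem_ellipsoid ?_, fun h => ?_⟩
  · rw [Finset.sum_singleton, ← mul_pow, mul_inv_cancel₀ this, one_pow]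
  · have h1 := finiteSignal_apply {j} (fun j => (a j)⁻¹) j
    rw [h] at h1
    simp at h1
    exact this h1.symm

end FiniteSignals

/-! ### The two constructions of hard alternatives. -/

section LowerBounds

variable {a b : ℕ+ → ℝ} {𝓑 𝓥 : Set (ℕ+ → ℝ)} {α β ε σ : ℝ}

/-- The nonparametric testing lower bound with known singular values. -/
lemma le_minimaxRadius_of_sign_prior (ha_pos : ∀ j, 0 < a j) (ha_mono : Monotone a)
    (hb_pos : ∀ j, 0 < b j) (hb𝓑 : b ∈ 𝓑) (hb𝓥 : b ∈ 𝓥) (hα : 0 ≤ α) (hβ : 0 ≤ β) (hε : 0 < ε)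
    {l : ℝ} (hl : 0 < l) (hlt : α + β + l < 1) {s : Finset ℕ+} (hs : s.Nonempty) {D : ℕ+}
    (hD : ∀ j ∈ s, j ≤ D) {ρ : ℝ} (hρ : 0 ≤ ρ) (hρa : a D * ρ ≤ 1)
    (hρb : ρ ^ 4 ≤ 2 * Real.log (1 + l ^ 2) * ε ^ 4 * ∑ j ∈ s, (b j ^ 4)⁻¹) :
    ρ ≤ minimaxRadius a 𝓑 𝓥 α β ε σ := by
  refine le_minimaxRadius ha_pos ha_mono fun Ψ hΨ r hr => ?_
  set S := ∑ j ∈ s, (b j ^ 4)⁻¹ with hS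
  have hSpos : 0 < S := Finset.sum_pos (fun j _ => by have := hb_pos j; positivity) hs
  -- Taking `g j ^ 2` proportional to `b j ^ (-4)` minimizes `∑ (b j * g j) ^ 4` for fixed norm `ρ`;
  -- the minimum is `ρ ^ 4 / S`, which is where `hρb` comes from.
  set g : ℕ+ → ℝ := fun j => ρ * (b j ^ 2)⁻¹ / √S with hg
  have hg2 : ∀ j, g j ^ 2 = ρ ^ 2 / S * (b j ^ 4)⁻¹ := fun j => by
    rw [hg]
    simp only [div_pow, mul_pow, Real.sq_sqrt hSpos.le, inv_pow, ← pow_mul]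
    ring
  have hsum : ∑ j ∈ s, g j ^ 2 = ρ ^ 2 := by
    simp_rw [hg2]
    rw [← Finset.mul_sum, ← hS]
    field_simp
  set v : ℝ≥0 := Real.toNNReal (ε ^ 2) with hv
  have hvε : (v : ℝ) = ε ^ 2 := Real.coe_toNNReal _ (by positivity)
  have hv0 : v ≠ 0 := by
    rw [← NNReal.coe_ne_zero, hvε]; positivity
  set θ₀ := finiteSignal {1} (fun j => (a j)⁻¹)
  obtain ⟨t, ht⟩ := exists_sign_measure_le_add (fun j => b j * θ₀ j) (fun j => b j * g j) hv0 s hl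
    (by
      rw [hvε]
      have e : ∀ j ∈ s, (b j * g j) ^ 4 / (2 * (ε ^ 2) ^ 2) =
          ρ ^ 4 / (2 * ε ^ 4 * S ^ 2) * (b j ^ 4)⁻¹ := fun j _ => by
        have := (hb_pos j).ne'
        have e1 : (b j * g j) ^ 4 = b j ^ 4 * (g j ^ 2) ^ 2 := by ring
        rw [e1, hg2]
        field_simp
      rw [Finset.sum_congr rfl e, ← Finset.mul_sum, ← hS, div_mul_eq_mul_div, div_le_iff₀ (by positivity)]
      calc ρ ^ 4 * S ≤ (2 * Real.log (1 + l ^ 2) * ε ^ 4 * S) * S := by gcongr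
        _ = _ := by ring)
    (Measure.infinitePi fun j : ℕ+ => gaussianReal (b j) (Real.toNNReal (σ ^ 2)))
    (measurableSet_accept Ψ θ₀)
  set w : ℕ+ → ℝ := fun j => if j ∈ t then g j else -g j
  have hw : ∀ j, w j ^ 2 = g j ^ 2 := fun j => by simp only [w]; split_ifs <;> ring
  refine lt_secondKindError hΨ hα hβ hl.le hlt (θ := θ₀ + finiteSignal s w)
    (finiteSignal_singleton_mem_benchmarks ha_pos 1) hb𝓑 hb𝓥 ?_ (ht.trans (le_of_eq ?_))
  · rw [add_sub_cancel_left]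
    refine ⟨finiteSignal_mem_ellipsoid ?_, hr.trans ?_⟩
    · calc ∑ j ∈ s, a j ^ 2 * w j ^ 2 ≤ ∑ j ∈ s, a D ^ 2 * g j ^ 2 := by
            refine Finset.sum_le_sum fun j hj => ?_
            rw [hw]
            have := ha_mono (hD j hj)
            have := (ha_pos j).le
            gcongr
        _ = (a D * ρ) ^ 2 := by rw [← Finset.mul_sum, hsum]; ring
        _ ≤ 1 := pow_le_one₀ (mul_nonneg (ha_pos D).le hρ) hρa
    · refine le_of_eq ((pow_left_inj₀ hρ (norm_nonneg _) two_ne_zero).1 ?_)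
      rw [norm_sq_finiteSignal, ← hsum]
      exact Finset.sum_congr rfl fun j _ => (hw j).symm
  · congr 2
    simp only [law, ← hv]
    congr 3
    ext1 j
    congr 1
    rw [lp.coeFn_add, Pi.add_apply, finiteSignal_apply s w]
    simp only [w]
    split_ifs <;> ring

/-- The lower bound due to the singular values being unknown up to the class. -/
lemma le_minimaxRadius_of_unknown_singular_value (ha_pos : ∀ j, 0 < a j) (ha_mono : Monotone a)
    (hb𝓥 : b ∈ 𝓥) (hα : 0 ≤ α) (hβ : 0 ≤ β) (hσ : 0 < σ)
    {l : ℝ} (hl : 0 < l) (hlt : α + β + l < 1) (j : ℕ+) {x : ℝ} (hx : |x| ≤ 1)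
    (hx𝓑 : Function.update b j (b j * (1 + x)) ∈ 𝓑)
    (hxb : (x * b j) ^ 2 ≤ Real.log (1 + l ^ 2) * σ ^ 2) :
    |x| / a j ≤ minimaxRadius a 𝓑 𝓥 α β ε σ := by
  refine le_minimaxRadius ha_pos ha_mono fun Ψ hΨ r hr => ?_
  have haj := ha_pos j
  set v : ℝ≥0 := Real.toNNReal (σ ^ 2) with hv
  have hvσ : (v : ℝ) = σ ^ 2 := Real.coe_toNNReal _ (by positivity)
  have hv0 : v ≠ 0 := by
    rw [← NNReal.coe_ne_zero, hvσ]; positivity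
  set θ₀ := finiteSignal {j} (fun j => (a j)⁻¹)
  -- Under the null the singular values are `ν` and the signal `θ₀`; under the alternative they are
  -- `b` and `(1 + x) θ₀`. The means of `Y` agree, so only the shift `x * b j` of `X j` has to be
  -- hidden.
  set ν := Function.update b j (b j * (1 + x))
  have H := shift_measure_le_add ν b hv0 j
    (fun i hi => by simp [ν, hi]) hl
    (by
      rw [hvσ, div_le_iff₀ (by positivity)]
      refine le_of_eq_of_le ?_ hxb
      simp only [ν, Function.update_self]
      ring)
    (Measure.infinitePi fun j : ℕ+ => gaussianReal (ν j * θ₀ j) (Real.toNNReal (ε ^ 2)))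
    (measurableSet_accept Ψ θ₀)
  refine lt_secondKindError hΨ hα hβ hl.le hlt
    (θ := θ₀ + finiteSignal {j} (fun j => x * (a j)⁻¹))
    (finiteSignal_singleton_mem_benchmarks ha_pos j) hx𝓑 hb𝓥 ?_ (H.trans (le_of_eq ?_))
  · rw [add_sub_cancel_left]
    refine ⟨finiteSignal_mem_ellipsoid ?_, hr.trans ?_⟩
    · rw [Finset.sum_singleton]
      have e : a j ^ 2 * (x * (a j)⁻¹) ^ 2 = |x| ^ 2 := by
        rw [sq_abs]; field_simp
      rw [e]
      exact pow_le_one₀ (abs_nonneg _) hx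
    · refine le_of_eq ((pow_left_inj₀ (by positivity) (norm_nonneg _) two_ne_zero).1 ?_)
      rw [norm_sq_finiteSignal, Finset.sum_singleton, div_pow, sq_abs]
      field_simp
  · congr 2
    simp only [law, ← hv]
    congr 3
    ext1 i
    congr 1
    rw [lp.coeFn_add, Pi.add_apply]
    simp only [θ₀, finiteSignal_apply, Finset.mem_singleton, ν]
    split_ifs with hi
    · subst hi
      rw [Function.update_self]
      ring
    · simp

end LowerBounds

/-! ### Bounds with constants independent of the noise levels. -/

section Bounds

variable {a b : ℕ+ → ℝ} {𝓥 : Set (ℕ+ → ℝ)} {α β : ℝ}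

lemma exists_sign_prior_bound (hα : α ∈ Set.Ioo (0 : ℝ) 1) (hβ : β ∈ Set.Ioo (0 : ℝ) (1 - α))
    (ha_pos : ∀ j, 0 < a j) (ha_mono : Monotone a) (hb_pos : ∀ j, 0 < b j) {C₀ C₁ : ℝ}
    (hC₀ : C₀ ≤ 1) (hC₁ : 1 ≤ C₁) (hb𝓥 : b ∈ 𝓥) :
    ∃ c > 0, ∀ ε σ : ℝ, 0 < ε → ∀ (s : Finset ℕ+) (D : ℕ+), s.Nonempty → (∀ j ∈ s, j ≤ D) →
      c * min (ε ^ 2 * √(∑ j ∈ s, ((b j ^ 2)⁻¹) ^ 2)) (a D ^ 2)⁻¹ ≤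
        minimaxRadius a (singularClass b C₀ C₁) 𝓥 α β ε σ ^ 2 := by
  obtain ⟨hα0, -⟩ := hα
  obtain ⟨hβ0, hβ1⟩ := hβ
  set l := (1 - α - β) / 2 with hl
  have hlpos : 0 < l := by rw [hl]; linarith
  have hlog : 0 < Real.log (1 + l ^ 2) := Real.log_pos (by nlinarith)
  -- With `ρ ^ 2 = c * y`, the bound `c ≤ 1` keeps the signal in the ellipsoid and `c ^ 2 ≤ 2 * log
  -- (1 + l ^ 2)` controls the second moment.
  refine ⟨min 1 √(2 * Real.log (1 + l ^ 2)), by positivity, fun ε σ hε s D hs hD => ?_⟩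
  set c := min 1 √(2 * Real.log (1 + l ^ 2)) with hc
  have hc0 : 0 < c := by positivity
  have hc1 : c ≤ 1 := min_le_left _ _
  have hc2 : c ^ 2 ≤ 2 * Real.log (1 + l ^ 2) := by
    rw [← Real.le_sqrt' hc0]; exact min_le_right _ _
  have hb𝓑 : b ∈ singularClass b C₀ C₁ := fun j =>
    ⟨mul_le_of_le_one_left (hb_pos j).le hC₀, le_mul_of_one_le_left (hb_pos j).le hC₁⟩
  have hS : 0 ≤ ∑ j ∈ s, ((b j ^ 2)⁻¹) ^ 2 := Finset.sum_nonneg fun j _ => by positivity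
  set S := ∑ j ∈ s, ((b j ^ 2)⁻¹) ^ 2 with hSdef
  have haD := ha_pos D
  set y := min (ε ^ 2 * √S) (a D ^ 2)⁻¹ with hy
  have hy0 : 0 ≤ y := le_min (by positivity) (by positivity)
  have h := le_minimaxRadius_of_sign_prior (σ := σ) ha_pos ha_mono hb_pos hb𝓑 hb𝓥 hα0.le hβ0.le hε
    hlpos (by rw [hl]; linarith) hs hD (ρ := √(c * y)) (Real.sqrt_nonneg _) ?_ ?_
  · rw [← Real.sq_sqrt (mul_nonneg hc0.le hy0)]
    gcongr
  · rw [← sq_le_one_iff₀ (by positivity), mul_pow, Real.sq_sqrt (by positivity)]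
    calc a D ^ 2 * (c * y) ≤ a D ^ 2 * (1 * (a D ^ 2)⁻¹) := by
          gcongr
          exact min_le_right _ _
      _ = 1 := by field_simp
  · have e : √(c * y) ^ 4 = c ^ 2 * y ^ 2 := by
      rw [show √(c * y) ^ 4 = (√(c * y) ^ 2) ^ 2 by ring, Real.sq_sqrt (by positivity)]
      ring
    have e2 : ∑ j ∈ s, (b j ^ 4)⁻¹ = S :=
      Finset.sum_congr rfl fun j _ => by rw [inv_pow, ← pow_mul]
    rw [e, e2]
    calc c ^ 2 * y ^ 2 ≤ 2 * Real.log (1 + l ^ 2) * (ε ^ 2 * √S) ^ 2 := by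
          gcongr
          exact min_le_left _ _
      _ = _ := by rw [mul_pow, Real.sq_sqrt hS]; ring

lemma exists_unknown_singular_value_bound (hα : α ∈ Set.Ioo (0 : ℝ) 1)
    (hβ : β ∈ Set.Ioo (0 : ℝ) (1 - α))
    (ha_pos : ∀ j, 0 < a j) (ha_mono : Monotone a) (hb_pos : ∀ j, 0 < b j) {C₀ C₁ : ℝ}
    (hC₀ : C₀ ≤ 1) (hC₁ : 1 ≤ C₁) (hC : C₀ < C₁) (hb𝓥 : b ∈ 𝓥) :
    ∃ c > 0, ∀ ε σ : ℝ, 0 < σ → ∀ j : ℕ+,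
      c * (min (σ ^ 2 * (b j ^ 2)⁻¹) 1 * (a j ^ 2)⁻¹) ≤
        minimaxRadius a (singularClass b C₀ C₁) 𝓥 α β ε σ ^ 2 := by
  obtain ⟨hα0, -⟩ := hα
  obtain ⟨hβ0, hβ1⟩ := hβ
  set l := (1 - α - β) / 2 with hl
  have hlpos : 0 < l := by rw [hl]; linarith
  have hlog : 0 < Real.log (1 + l ^ 2) := Real.log_pos (by nlinarith)
  -- As `C₀ < C₁`, there is room above `1` or below it; `u` is the sign of an admissible
  -- perturbation and `d` its largest size, capped at `1` for the ellipsoid.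
  obtain ⟨u, d, hu, hd0, hd1, hud⟩ : ∃ u d : ℝ, |u| = 1 ∧ 0 < d ∧ d ≤ 1 ∧
      ∀ x, 0 ≤ x → x ≤ d → C₀ ≤ 1 + u * x ∧ 1 + u * x ≤ C₁ := by
    rcases hC₁.lt_or_eq with h | h
    · refine ⟨1, min (C₁ - 1) 1, by simp, lt_min (by linarith) one_pos, min_le_right _ _,
        fun x hx hxd => ⟨by linarith, ?_⟩⟩
      have := hxd.trans (min_le_left _ _)
      linarith
    · refine ⟨-1, min (1 - C₀) 1, by simp, lt_min (by linarith) one_pos, min_le_right _ _,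
        fun x hx hxd => ⟨?_, by linarith⟩⟩
      have := hxd.trans (min_le_left _ _)
      linarith
  refine ⟨min (Real.log (1 + l ^ 2)) (d ^ 2), by positivity, fun ε σ hσ j => ?_⟩
  set c := min (Real.log (1 + l ^ 2)) (d ^ 2) with hc
  have hc0 : 0 < c := by positivity
  have haj := ha_pos j
  have hbj := hb_pos j
  set y := min (σ ^ 2 * (b j ^ 2)⁻¹) 1 with hy
  have hy0 : 0 ≤ y := by positivity
  have hx2 : √(c * y) ^ 2 = c * y := Real.sq_sqrt (by positivity)
  have hxd : √(c * y) ≤ d := by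
    rw [Real.sqrt_le_left hd0.le]
    calc c * y ≤ d ^ 2 * 1 := by
          gcongr
          · exact min_le_right _ _
          · exact min_le_right _ _
      _ = d ^ 2 := mul_one _
  have habs : |u * √(c * y)| = √(c * y) := by
    rw [abs_mul, hu, one_mul, abs_of_nonneg (Real.sqrt_nonneg _)]
  have h := le_minimaxRadius_of_unknown_singular_value (ε := ε) (𝓑 := singularClass b C₀ C₁)
    ha_pos ha_mono hb𝓥 hα0.le hβ0.le hσ hlpos (by rw [hl]; linarith) j (x := u * √(c * y))
    (by rw [habs]; exact hxd.trans hd1) ?_ ?_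
  · rw [habs] at h
    rw [← mul_assoc, ← hx2, ← div_eq_mul_inv, ← div_pow]
    gcongr
  · intro i
    by_cases hi : i = j
    · subst hi
      obtain ⟨h1, h2⟩ := hud _ (Real.sqrt_nonneg _) hxd
      rw [Function.update_self, mul_comm (b i)]
      exact ⟨by gcongr, by gcongr⟩
    · rw [Function.update_of_ne hi]
      exact ⟨mul_le_of_le_one_left (hb_pos i).le hC₀, le_mul_of_one_le_left (hb_pos i).le hC₁⟩
  · rw [mul_pow, ← sq_abs (u * _), habs, hx2]
    calc c * y * b j ^ 2 ≤ Real.log (1 + l ^ 2) * (σ ^ 2 * (b j ^ 2)⁻¹) * b j ^ 2 := by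
          gcongr
          · exact min_le_left _ _
          · exact min_le_left _ _
      _ = _ := by field_simp

end Bounds

/-! ### Reduction to deterministic rates. -/

/-- `ρ` is, up to a constant, dominated by the sign-prior lower bounds, for the squared inverse
singular values `B` and squared inverse ellipsoid weights `A`. -/
def SignPriorRate (A B : ℕ+ → ℝ) (ρ : ℝ → ℝ) : Prop :=
  ∃ κ > 0, ∀ ε, 0 < ε → ε ≤ Real.exp (-1) → ∃ (s : Finset ℕ+) (D : ℕ+), s.Nonempty ∧
    (∀ j ∈ s, j ≤ D) ∧ κ * ρ ε ≤ min (ε ^ 2 * √(∑ j ∈ s, B j ^ 2)) (A D)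

/-- `ρ` is, up to a constant, dominated by the lower bounds due to the unknown singular values. -/
def UnknownOperatorRate (A B : ℕ+ → ℝ) (ρ : ℝ → ℝ) : Prop :=
  ∃ κ > 0, ∀ σ, 0 < σ → σ ≤ Real.exp (-1) → ∃ j : ℕ+, κ * ρ σ ≤ min (σ ^ 2 * B j) 1 * A j

lemma gtrsimSmallNoise_max {α β : ℝ} (hα : α ∈ Set.Ioo (0 : ℝ) 1)
    (hβ : β ∈ Set.Ioo (0 : ℝ) (1 - α)) {a b : ℕ+ → ℝ}
    (ha_pos : ∀ j, 0 < a j) (ha_mono : Monotone a) (hb_pos : ∀ j, 0 < b j) {C₀ C₁ : ℝ}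
    (hC₀ : C₀ ≤ 1) (hC₁ : 1 ≤ C₁) (hC : C₀ < C₁) {𝓥 : Set (ℕ+ → ℝ)} (hb𝓥 : b ∈ 𝓥)
    {ρ₁ ρ₂ : ℝ → ℝ} (h₁ : SignPriorRate (fun j => (a j ^ 2)⁻¹) (fun j => (b j ^ 2)⁻¹) ρ₁)
    (h₂ : UnknownOperatorRate (fun j => (a j ^ 2)⁻¹) (fun j => (b j ^ 2)⁻¹) ρ₂) :
    GtrsimSmallNoise (fun ε σ => minimaxRadius a (singularClass b C₀ C₁) 𝓥 α β ε σ ^ 2)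
      (fun ε σ => max (ρ₁ ε) (ρ₂ σ)) := by
  obtain ⟨c₁, hc₁, H₁⟩ := exists_sign_prior_bound hα hβ ha_pos ha_mono hb_pos hC₀ hC₁ hb𝓥
  obtain ⟨c₂, hc₂, H₂⟩ :=
    exists_unknown_singular_value_bound hα hβ ha_pos ha_mono hb_pos hC₀ hC₁ hC hb𝓥
  obtain ⟨κ₁, hκ₁, h₁⟩ := h₁
  obtain ⟨κ₂, hκ₂, h₂⟩ := h₂
  have he : Real.exp (-1) ∈ Set.Ioo (0 : ℝ) 1 := ⟨Real.exp_pos _, by simp⟩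
  refine ⟨_, he, _, he, min (c₁ * κ₁) (c₂ * κ₂), by positivity, fun ε σ hε hε' hσ hσ' => ?_⟩
  beta_reduce
  -- No sign is assumed of `ρ₁` and `ρ₂`: the constant may be lowered to the minimum only for a
  -- nonnegative maximum, and otherwise the squared radius wins trivially.
  rcases le_total 0 (max (ρ₁ ε) (ρ₂ σ)) with h0 | h0
  · rcases le_total (ρ₁ ε) (ρ₂ σ) with h | h
    · rw [max_eq_right h] at h0 ⊢
      obtain ⟨j, hj⟩ := h₂ σ hσ hσ'
      calc min (c₁ * κ₁) (c₂ * κ₂) * ρ₂ σ ≤ (c₂ * κ₂) * ρ₂ σ := by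
            gcongr; exact min_le_right _ _
        _ = c₂ * (κ₂ * ρ₂ σ) := mul_assoc _ _ _
        _ ≤ _ := (mul_le_mul_of_nonneg_left hj hc₂.le).trans (H₂ ε σ hσ j)
    · rw [max_eq_left h] at h0 ⊢
      obtain ⟨s, D, hs, hD, hj⟩ := h₁ ε hε hε'
      calc min (c₁ * κ₁) (c₂ * κ₂) * ρ₁ ε ≤ (c₁ * κ₁) * ρ₁ ε := by
            gcongr; exact min_le_left _ _
        _ = c₁ * (κ₁ * ρ₁ ε) := mul_assoc _ _ _
        _ ≤ _ := (mul_le_mul_of_nonneg_left hj hc₁.le).trans (H₁ ε σ hε s D hs hD)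
  · exact (mul_nonpos_of_nonneg_of_nonpos (by positivity) h0).trans (sq_nonneg _)

/-! ### Choice of block or index in each regime. -/

section Rates

lemma Comparable.exists_mul_le_inv_sq {c d : ℕ+ → ℝ} (hc : ∀ j, 0 < c j) (hd : ∀ j, 0 < d j)
    (h : Comparable c d) : ∃ k > 0, ∀ j, k * (d j ^ 2)⁻¹ ≤ (c j ^ 2)⁻¹ := by
  obtain ⟨κ₀, κ₁, h0, h1, h⟩ := h
  have hκ : 0 < κ₁ := h0.trans_le h1
  refine ⟨(κ₁ ^ 2)⁻¹, by positivity, fun j => ?_⟩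
  have := hc j
  have := hd j
  rw [← mul_inv, ← mul_pow]
  gcongr
  exact (div_le_iff₀ this).1 (h j).2

lemma exists_pnat_between {x : ℝ} (hx : 0 < x) :
    ∃ n : ℕ+, x ≤ ((n : ℕ) : ℝ) ∧ ((n : ℕ) : ℝ) ≤ x + 1 :=
  ⟨⟨⌈x⌉₊, Nat.ceil_pos.2 hx⟩, Nat.le_ceil x, (Nat.ceil_lt_add_one hx.le).le⟩

lemma one_le_log_inv {ε : ℝ} (hε : 0 < ε) (hε' : ε ≤ Real.exp (-1)) : 1 ≤ Real.log (1 / ε) := by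
  rw [one_div, Real.log_inv]
  have := Real.log_le_log hε hε'
  rw [Real.log_exp] at this
  linarith

lemma rpow_eq_exp_log_inv {ε : ℝ} (hε : 0 < ε) (y : ℝ) :
    ε ^ y = Real.exp (-(Real.log (1 / ε) * y)) := by
  rw [Real.rpow_def_of_pos hε, one_div, Real.log_inv]
  ring_nf

lemma sq_eq_exp_log_inv {ε : ℝ} (hε : 0 < ε) : ε ^ 2 = Real.exp (-(Real.log (1 / ε) * 2)) := by
  rw [← rpow_eq_exp_log_inv hε, Real.rpow_two]

variable {A B : ℕ+ → ℝ} {kA kB s t : ℝ}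

/-- The block from `m` to `2 * m` has `m + 1` terms of at least the size of the first lower bound;
the square root of their number is the source of the `1 / 2` in the exponents. -/
lemma mul_rpow_le_sqrt_sum_sq (hkB : 0 < kB) (ht : 0 < t)
    (hB : ∀ j : ℕ+, kB * ((j : ℕ) : ℝ) ^ (2 * t) ≤ B j) (m : ℕ+) :
    kB * ((m : ℕ) : ℝ) ^ (2 * t + 1 / 2) ≤ √(∑ j ∈ Finset.Icc m (2 * m), B j ^ 2) := by
  have hm : (0 : ℝ) < (m : ℕ) := by exact_mod_cast m.pos
  apply Real.le_sqrt_of_sq_le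
  have h1 : ∀ j ∈ Finset.Icc m (2 * m), (kB * ((m : ℕ) : ℝ) ^ (2 * t)) ^ 2 ≤ B j ^ 2 := by
    intro j hj
    have hmj : ((m : ℕ) : ℝ) ≤ (j : ℕ) := by exact_mod_cast (Finset.mem_Icc.1 hj).1
    have := hB j
    refine pow_le_pow_left₀ (by positivity) (le_trans ?_ this) 2
    gcongr
  have h2 := Finset.card_nsmul_le_sum _ _ _ h1
  refine le_trans ?_ h2
  rw [nsmul_eq_mul, PNat.card_Icc]
  have h3 : ((m : ℕ) : ℝ) ≤ ((((2 * m : ℕ+) : ℕ) + 1 - (m : ℕ) : ℕ) : ℝ) := by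
    have h4 : ((2 : ℕ+) : ℕ) = 2 := rfl
    rw [Nat.cast_le, PNat.mul_coe, h4]
    omega
  refine le_trans (le_of_eq ?_) (mul_le_mul_of_nonneg_right h3 (sq_nonneg _))
  rw [Real.rpow_add hm, ← Real.sqrt_eq_rpow, ← mul_assoc, mul_pow, Real.sq_sqrt hm.le]
  ring

/-- Balance `ε ^ 2 * m ^ (2 t + 1 / 2)` against `m ^ (-2 s)`: they agree at `m = ε ^ (-2 / q)`. -/
lemma signPriorRate_of_poly_of_poly (hs : 0 < s) (ht : 0 < t) (hkA : 0 < kA) (hkB : 0 < kB)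
    (hA : ∀ j : ℕ+, kA * ((j : ℕ) : ℝ) ^ (-(2 * s)) ≤ A j)
    (hB : ∀ j : ℕ+, kB * ((j : ℕ) : ℝ) ^ (2 * t) ≤ B j) :
    SignPriorRate A B fun ε => ε ^ (4 * s / (2 * s + 2 * t + 1 / 2)) := by
  set q := 2 * s + 2 * t + 1 / 2 with hq
  have hq0 : 0 < q := by positivity
  -- The factor `4` covers rounding and doubling: `2 m ≤ 2 (x + 1) ≤ 4 x`, as `1 ≤ x`.
  refine ⟨min kB (kA * 4 ^ (-(2 * s))), by positivity, fun ε hε hε' => ?_⟩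
  have hε1 : ε ≤ 1 := hε'.trans (by simp)
  set x := ε ^ (-(2 / q)) with hx
  have hx1 : 1 ≤ x := Real.one_le_rpow_of_pos_of_le_one_of_nonpos hε hε1
    (by have : 0 < 2 / q := by positivity
        linarith)
  obtain ⟨m, hm1, hm2⟩ := exists_pnat_between (one_pos.trans_le hx1)
  refine ⟨Finset.Icc m (2 * m), 2 * m, ⟨m, ?_⟩, fun j hj => (Finset.mem_Icc.1 hj).2, le_min ?_ ?_⟩
  · rw [Finset.mem_Icc, ← PNat.coe_le_coe m (2 * m), PNat.mul_coe]
    exact ⟨le_rfl, Nat.le_mul_of_pos_left _ (by decide)⟩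
  · calc min kB (kA * 4 ^ (-(2 * s))) * ε ^ (4 * s / q) ≤ kB * ε ^ (4 * s / q) := by
          gcongr; exact min_le_left _ _
      _ = ε ^ 2 * (kB * x ^ (2 * t + 1 / 2)) := by
          rw [hx, ← Real.rpow_mul hε.le, mul_left_comm, ← Real.rpow_two, ← Real.rpow_add hε]
          congr 2
          field_simp
          rw [hq]
          ring
      _ ≤ ε ^ 2 * (kB * ((m : ℕ) : ℝ) ^ (2 * t + 1 / 2)) := by gcongr
      _ ≤ _ := by
          gcongr
          exact mul_rpow_le_sqrt_sum_sq hkB ht hB m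
  · calc min kB (kA * 4 ^ (-(2 * s))) * ε ^ (4 * s / q)
        ≤ (kA * 4 ^ (-(2 * s))) * ε ^ (4 * s / q) := by
          gcongr; exact min_le_right _ _
      _ = kA * (4 * x) ^ (-(2 * s)) := by
          rw [Real.mul_rpow (by norm_num) (by positivity), hx, ← Real.rpow_mul hε.le, mul_assoc]
          congr 3
          ring
      _ ≤ kA * (((2 * m : ℕ+) : ℕ) : ℝ) ^ (-(2 * s)) := by
          gcongr kA * ?_
          refine Real.rpow_le_rpow_of_nonpos (by exact_mod_cast (2 * m).pos) ?_ (by linarith)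
          rw [PNat.mul_coe]
          push_cast
          linarith
      _ ≤ A (2 * m) := hA _

/-- No exact balance is needed. With `m` about `L / (4 s)`, where `L = log (1 / ε)`, the cap `A (2
m)` is at least of order `ε`, which dominates `ε ^ 2 * L ^ q` because `L ^ q` is at most of order `1
/ ε`. -/
lemma signPriorRate_of_exp_of_poly (hs : 0 < s) (ht : 0 < t) (hkA : 0 < kA) (hkB : 0 < kB)
    (hA : ∀ j : ℕ+, kA * Real.exp (-(2 * s * (j : ℕ))) ≤ A j)
    (hB : ∀ j : ℕ+, kB * ((j : ℕ) : ℝ) ^ (2 * t) ≤ B j) :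
    SignPriorRate A B fun ε => ε ^ 2 * Real.log (1 / ε) ^ (2 * t + 1 / 2) := by
  set q := 2 * t + 1 / 2 with hq
  have hq0 : 0 < q := by positivity
  refine ⟨min (kB * (1 / (4 * s)) ^ q) (kA * Real.exp (-(4 * s)) * (1 / q) ^ q),
    by positivity, fun ε hε hε' => ?_⟩
  set L := Real.log (1 / ε) with hL
  have hL1 : 1 ≤ L := one_le_log_inv hε hε'
  have hL0 : 0 < L := by linarith
  obtain ⟨m, hm1, hm2⟩ := exists_pnat_between (x := L / (4 * s)) (by positivity)
  refine ⟨Finset.Icc m (2 * m), 2 * m, ⟨m, ?_⟩, fun j hj => (Finset.mem_Icc.1 hj).2, le_min ?_ ?_⟩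
  · rw [Finset.mem_Icc, ← PNat.coe_le_coe m (2 * m), PNat.mul_coe]
    exact ⟨le_rfl, Nat.le_mul_of_pos_left _ (by decide)⟩
  · calc _ ≤ (kB * (1 / (4 * s)) ^ q) * (ε ^ 2 * L ^ q) := by
          gcongr; exact min_le_left _ _
      _ = ε ^ 2 * (kB * (L / (4 * s)) ^ q) := by
          rw [div_eq_mul_one_div L, Real.mul_rpow (by positivity) (by positivity)]
          ring
      _ ≤ ε ^ 2 * (kB * ((m : ℕ) : ℝ) ^ q) := by gcongr
      _ ≤ _ := by
          gcongr
          exact mul_rpow_le_sqrt_sum_sq hkB ht hB m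
  · have h1 : L * (1 / q) ≤ (1 / ε) ^ (1 / q) := by
      have := Real.log_le_rpow_div (x := 1 / ε) (by positivity) (one_div_pos.2 hq0)
      rwa [le_div_iff₀ (by positivity)] at this
    have h2 : L ^ q * (1 / q) ^ q ≤ 1 / ε := by
      rw [← Real.mul_rpow (by positivity) (by positivity)]
      refine (Real.rpow_le_rpow (by positivity) h1 hq0.le).trans (le_of_eq ?_)
      rw [← Real.rpow_mul (by positivity), one_div_mul_cancel hq0.ne', Real.rpow_one]
    calc _ ≤ (kA * Real.exp (-(4 * s)) * (1 / q) ^ q) * (ε ^ 2 * L ^ q) := by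
          gcongr; exact min_le_right _ _
      _ = kA * Real.exp (-(4 * s)) * ε ^ 2 * (L ^ q * (1 / q) ^ q) := by ring
      _ ≤ kA * Real.exp (-(4 * s)) * ε ^ 2 * (1 / ε) := by gcongr
      _ = kA * (Real.exp (-(4 * s)) * ε ^ (1 : ℝ)) := by
          rw [Real.rpow_one]; field_simp
      _ = kA * Real.exp (-(4 * s) + -(L * 1)) := by rw [rpow_eq_exp_log_inv hε, ← Real.exp_add]
      _ ≤ kA * Real.exp (-(2 * s * ((2 * m : ℕ+) : ℕ))) := by
          gcongr
          rw [PNat.mul_coe]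
          push_cast
          have h3 : ((m : ℕ) : ℝ) * (4 * s) ≤ (L / (4 * s) + 1) * (4 * s) := by gcongr
          rw [add_mul, div_mul_cancel₀ _ (by positivity)] at h3
          have h4 : (((2 : ℕ+) : ℕ) : ℝ) = 2 := rfl
          linarith
      _ ≤ A (2 * m) := hA _

/-- At `j` about `log (1 / ε) / t` the singular value has dropped to the noise level, and the weight
is a power of the logarithm. This one coordinate serves both the `ε` and the `σ` bound. -/
lemma exists_index_of_poly_of_exp (hs : 0 < s) (ht : 0 < t) (hkA : 0 < kA) (hkB : 0 < kB)
    (hA : ∀ j : ℕ+, kA * ((j : ℕ) : ℝ) ^ (-(2 * s)) ≤ A j)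
    (hB : ∀ j : ℕ+, kB * Real.exp (2 * t * (j : ℕ)) ≤ B j) {ε : ℝ} (hε : 0 < ε)
    (hε' : ε ≤ Real.exp (-1)) :
    ∃ j : ℕ+, kB ≤ ε ^ 2 * B j ∧
      kA * (1 / t + 1) ^ (-(2 * s)) * Real.log (1 / ε) ^ (-2 * s) ≤ A j := by
  set L := Real.log (1 / ε) with hL
  have hL1 : 1 ≤ L := one_le_log_inv hε hε'
  have hL0 : 0 < L := by linarith
  obtain ⟨j, hj1, hj2⟩ := exists_pnat_between (x := L / t) (by positivity)
  refine ⟨j, ?_, le_trans ?_ (hA j)⟩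
  · calc kB = ε ^ 2 * (kB * Real.exp (L * 2)) := by
          rw [sq_eq_exp_log_inv hε, ← hL, mul_left_comm, ← Real.exp_add, neg_add_cancel, Real.exp_zero,
            mul_one]
      _ ≤ ε ^ 2 * (kB * Real.exp (2 * t * (j : ℕ))) := by
          gcongr ε ^ 2 * (kB * Real.exp ?_)
          rw [div_le_iff₀ ht] at hj1
          linarith
      _ ≤ _ := by gcongr; exact hB j
  · rw [mul_assoc, neg_mul, ← Real.mul_rpow (by positivity) (by positivity)]
    gcongr kA * ?_
    refine Real.rpow_le_rpow_of_nonpos (by exact_mod_cast j.pos) ?_ (by linarith)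
    refine hj2.trans ?_
    rw [add_mul, one_mul, one_div_mul_eq_div]
    linarith

lemma log_inv_rpow_le_one (hs : 0 < s) {ε : ℝ} (hε : 0 < ε) (hε' : ε ≤ Real.exp (-1)) :
    Real.log (1 / ε) ^ (-2 * s) ≤ 1 :=
  Real.rpow_le_one_of_one_le_of_nonpos (one_le_log_inv hε hε') (by linarith)

lemma signPriorRate_of_poly_of_exp (hs : 0 < s) (ht : 0 < t) (hkA : 0 < kA) (hkB : 0 < kB)
    (hA : ∀ j : ℕ+, kA * ((j : ℕ) : ℝ) ^ (-(2 * s)) ≤ A j)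
    (hB : ∀ j : ℕ+, kB * Real.exp (2 * t * (j : ℕ)) ≤ B j) :
    SignPriorRate A B fun ε => Real.log (1 / ε) ^ (-2 * s) := by
  refine ⟨min kB (kA * (1 / t + 1) ^ (-(2 * s))), by positivity, fun ε hε hε' => ?_⟩
  obtain ⟨j, hj1, hj2⟩ := exists_index_of_poly_of_exp hs ht hkA hkB hA hB hε hε'
  have hL1 := one_le_log_inv hε hε'
  have hB0 : 0 ≤ B j := le_trans (by positivity) (hB j)
  refine ⟨{j}, j, ⟨j, by simp⟩, by simp, le_min ?_ (le_trans ?_ hj2)⟩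
  · rw [Finset.sum_singleton, Real.sqrt_sq hB0]
    calc _ ≤ kB * 1 := by
          gcongr
          · exact min_le_left _ _
          · exact log_inv_rpow_le_one hs hε hε'
      _ = kB := mul_one _
      _ ≤ _ := hj1
  · gcongr
    exact min_le_right _ _

lemma unknownOperatorRate_of_poly_of_exp (hs : 0 < s) (ht : 0 < t) (hkA : 0 < kA) (hkB : 0 < kB)
    (hA : ∀ j : ℕ+, kA * ((j : ℕ) : ℝ) ^ (-(2 * s)) ≤ A j)
    (hB : ∀ j : ℕ+, kB * Real.exp (2 * t * (j : ℕ)) ≤ B j) :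
    UnknownOperatorRate A B fun σ => Real.log (1 / σ) ^ (-2 * s) := by
  refine ⟨min kB 1 * (kA * (1 / t + 1) ^ (-(2 * s))), by positivity, fun ε hε hε' => ?_⟩
  obtain ⟨j, hj1, hj2⟩ := exists_index_of_poly_of_exp hs ht hkA hkB hA hB hε hε'
  have hL1 := one_le_log_inv hε hε'
  refine ⟨j, ?_⟩
  have hB0 : 0 ≤ B j := le_trans (by positivity) (hB j)
  rw [mul_assoc]
  gcongr

/-- A single coordinate suffices: `ε ^ 2 * exp (2 t j)` and `exp (-2 s j)` balance at `j = log (1 /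
ε) / (s + t)`, and rounding up costs `exp (-2 s)`. -/
lemma signPriorRate_of_exp_of_exp (hs : 0 < s) (ht : 0 < t) (hkA : 0 < kA) (hkB : 0 < kB)
    (hA : ∀ j : ℕ+, kA * Real.exp (-(2 * s * (j : ℕ))) ≤ A j)
    (hB : ∀ j : ℕ+, kB * Real.exp (2 * t * (j : ℕ)) ≤ B j) :
    SignPriorRate A B fun ε => ε ^ (2 * s / (s + t)) := by
  refine ⟨min kB (kA * Real.exp (-(2 * s))), by positivity, fun ε hε hε' => ?_⟩
  set L := Real.log (1 / ε) with hL
  have hL1 : 1 ≤ L := one_le_log_inv hε hε'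
  have hL0 : 0 < L := by linarith
  obtain ⟨j, hj1, hj2⟩ := exists_pnat_between (x := L / (s + t)) (by positivity)
  have hB0 : 0 ≤ B j := le_trans (by positivity) (hB j)
  refine ⟨{j}, j, ⟨j, by simp⟩, by simp, le_min ?_ ?_⟩
  · rw [Finset.sum_singleton, Real.sqrt_sq hB0]
    calc _ ≤ kB * ε ^ (2 * s / (s + t)) := by
          gcongr
          exact min_le_left _ _
      _ = ε ^ 2 * (kB * Real.exp (2 * t * (L / (s + t)))) := by
          rw [sq_eq_exp_log_inv hε, rpow_eq_exp_log_inv hε, mul_left_comm, ← Real.exp_add]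
          congr 2
          field_simp
          ring
      _ ≤ ε ^ 2 * (kB * Real.exp (2 * t * (j : ℕ))) := by gcongr
      _ ≤ _ := by gcongr; exact hB j
  · calc _ ≤ (kA * Real.exp (-(2 * s))) * ε ^ (2 * s / (s + t)) := by
          gcongr
          exact min_le_right _ _
      _ = kA * Real.exp (-(2 * s * (L / (s + t) + 1))) := by
          rw [rpow_eq_exp_log_inv hε, mul_assoc, ← Real.exp_add]
          congr 2
          field_simp
          ring
      _ ≤ kA * Real.exp (-(2 * s * (j : ℕ))) := by gcongr
      _ ≤ A j := hA j

/-- The first coordinate already gives the parametric rate, which is the larger one when `s ≥ t`. -/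
lemma unknownOperatorRate_sq (hA : 0 < A 1) (hB : 0 < B 1) :
    UnknownOperatorRate A B fun σ => σ ^ 2 := by
  refine ⟨min (B 1) 1 * A 1, by positivity, fun σ hσ hσ' => ⟨1, ?_⟩⟩
  have hσ1 : σ ^ 2 ≤ 1 := pow_le_one₀ hσ.le (hσ'.trans (by simp))
  rw [mul_right_comm]
  gcongr
  refine le_min ?_ ?_
  · rw [mul_comm]
    gcongr
    exact min_le_left _ _
  · exact mul_le_one₀ (min_le_right _ _) (by positivity) hσ1

/-- Take `j` about `log (1 / σ) / t`, where `σ ^ 2 * B j` reaches a constant; what remains is `A j`,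
of order at least `σ ^ (2 s / t)`. -/
lemma unknownOperatorRate_of_exp_of_exp (hs : 0 < s) (ht : 0 < t) (hkA : 0 < kA) (hkB : 0 < kB)
    (hA : ∀ j : ℕ+, kA * Real.exp (-(2 * s * (j : ℕ))) ≤ A j)
    (hB : ∀ j : ℕ+, kB * Real.exp (2 * t * (j : ℕ)) ≤ B j) :
    UnknownOperatorRate A B fun σ => σ ^ (2 * (s / t)) := by
  refine ⟨min kB 1 * (kA * Real.exp (-(2 * s))), by positivity, fun ε hε hε' => ?_⟩
  set L := Real.log (1 / ε) with hL
  have hL1 : 1 ≤ L := one_le_log_inv hε hε'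
  have hL0 : 0 < L := by linarith
  obtain ⟨j, hj1, hj2⟩ := exists_pnat_between (x := L / t) (by positivity)
  refine ⟨j, ?_⟩
  have hB0 : 0 ≤ B j := le_trans (by positivity) (hB j)
  rw [mul_assoc]
  beta_reduce
  refine mul_le_mul (min_le_min_right _ ?_) ?_ (by positivity) (by positivity)
  · calc kB = ε ^ 2 * (kB * Real.exp (L * 2)) := by
          rw [sq_eq_exp_log_inv hε, ← hL, mul_left_comm, ← Real.exp_add, neg_add_cancel, Real.exp_zero,
            mul_one]
      _ ≤ ε ^ 2 * (kB * Real.exp (2 * t * (j : ℕ))) := by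
          gcongr ε ^ 2 * (kB * Real.exp ?_)
          rw [div_le_iff₀ ht] at hj1
          linarith
      _ ≤ _ := by gcongr; exact hB j
  · calc _ = kA * Real.exp (-(2 * s * (L / t + 1))) := by
          rw [rpow_eq_exp_log_inv hε, mul_assoc, ← Real.exp_add]
          congr 2
          field_simp
          ring
      _ ≤ kA * Real.exp (-(2 * s * (j : ℕ))) := by gcongr
      _ ≤ A j := hA j

lemma unknownOperatorRate_of_poly_of_poly (hs : 0 < s) (ht : 0 < t) (hkA : 0 < kA) (hkB : 0 < kB)
    (hA : ∀ j : ℕ+, kA * ((j : ℕ) : ℝ) ^ (-(2 * s)) ≤ A j)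
    (hB : ∀ j : ℕ+, kB * ((j : ℕ) : ℝ) ^ (2 * t) ≤ B j) :
    UnknownOperatorRate A B fun σ => σ ^ (2 * (s / t)) := by
  -- Here `j` is about `x = σ ^ (-1 / t)`, and the factor `2` absorbs rounding: `j ≤ x + 1 ≤ 2 x`.
  refine ⟨min kB 1 * (kA * 2 ^ (-(2 * s))), by positivity, fun σ hσ hσ' => ?_⟩
  have hσ1 : σ ≤ 1 := hσ'.trans (by simp)
  set x := σ ^ (-(1 / t)) with hx
  have hx1 : 1 ≤ x := Real.one_le_rpow_of_pos_of_le_one_of_nonpos hσ hσ1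
    (by have : 0 < 1 / t := by positivity
        linarith)
  obtain ⟨j, hj1, hj2⟩ := exists_pnat_between (one_pos.trans_le hx1)
  refine ⟨j, ?_⟩
  have hB0 : 0 ≤ B j := le_trans (by positivity) (hB j)
  rw [mul_assoc]
  beta_reduce
  refine mul_le_mul (min_le_min_right _ ?_) ?_ (by positivity) (by positivity)
  · calc kB = σ ^ 2 * (kB * x ^ (2 * t)) := by
          rw [hx, ← Real.rpow_mul hσ.le, mul_left_comm, ← Real.rpow_two, ← Real.rpow_add hσ]
          have : (2 : ℝ) + -(1 / t) * (2 * t) = 0 := by field_simp; ring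
          rw [this, Real.rpow_zero, mul_one]
      _ ≤ σ ^ 2 * (kB * ((j : ℕ) : ℝ) ^ (2 * t)) := by gcongr
      _ ≤ _ := by gcongr; exact hB j
  · calc _ = kA * (2 * x) ^ (-(2 * s)) := by
          rw [Real.mul_rpow (by norm_num) (by positivity), hx, ← Real.rpow_mul hσ.le, mul_assoc]
          congr 3
          ring
      _ ≤ kA * ((j : ℕ) : ℝ) ^ (-(2 * s)) := by
          gcongr kA * ?_
          exact Real.rpow_le_rpow_of_nonpos (by exact_mod_cast j.pos) (by linarith) (by linarith)
      _ ≤ A j := hA j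

lemma unknownOperatorRate_min (hA : 0 < A 1) (hB : 0 < B 1)
    (h : UnknownOperatorRate A B fun σ => σ ^ (2 * (s / t))) :
    UnknownOperatorRate A B fun σ => σ ^ (2 * min (s / t) 1) := by
  rcases le_total (s / t) 1 with hst | hst
  · rwa [min_eq_left hst]
  · rw [min_eq_right hst, mul_one]
    simpa only [Real.rpow_two] using unknownOperatorRate_sq hA hB

end Rates

/-! ### Power and exponential bounds for the inverse squares. -/

section ComparableRates

variable {c : ℕ+ → ℝ} {x : ℝ}

lemma Comparable.exists_le_inv_sq_rpow (hc : ∀ j, 0 < c j)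
    (h : Comparable c fun j => ((j : ℕ) : ℝ) ^ x) :
    ∃ k > 0, ∀ j : ℕ+, k * ((j : ℕ) : ℝ) ^ (-(2 * x)) ≤ (c j ^ 2)⁻¹ := by
  have hpos : ∀ j : ℕ+, (0 : ℝ) < (j : ℕ) := fun j => by exact_mod_cast j.pos
  obtain ⟨k, hk, h⟩ := h.exists_mul_le_inv_sq hc fun j => Real.rpow_pos_of_pos (hpos j) _
  refine ⟨k, hk, fun j => le_of_eq_of_le ?_ (h j)⟩
  rw [← Real.rpow_two, ← Real.rpow_mul (hpos j).le, ← Real.rpow_neg (hpos j).le, mul_comm x]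

lemma Comparable.exists_le_inv_sq_exp (hc : ∀ j, 0 < c j)
    (h : Comparable c fun j => Real.exp (((j : ℕ) : ℝ) * x)) :
    ∃ k > 0, ∀ j : ℕ+, k * Real.exp (-(2 * x * (j : ℕ))) ≤ (c j ^ 2)⁻¹ := by
  obtain ⟨k, hk, h⟩ := h.exists_mul_le_inv_sq hc fun j => Real.exp_pos _
  refine ⟨k, hk, fun j => le_of_eq_of_le ?_ (h j)⟩
  rw [← Real.exp_nat_mul, ← Real.exp_neg]
  congr 2
  push_cast
  ring

end ComparableRates

end NoisyGSM

end

theorem theorem5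
    (α β : ℝ) (hα : α ∈ Set.Ioo (0 : ℝ) 1) (hβ : β ∈ Set.Ioo (0 : ℝ) (1 - α))
    (s t : ℝ) (hs : 0 < s) (ht : 0 < t)
    (a : ℕ+ → ℝ) (ha_pos : ∀ j, 0 < a j) (ha_mono : Monotone a) (ha_top : Tendsto a atTop atTop)
    (b : ℕ+ → ℝ) (hb_pos : ∀ j, 0 < b j)
    (C₀ C₁ : ℝ) (hC₀ : 0 < C₀) (hC₀' : C₀ ≤ 1) (hC₁ : 1 ≤ C₁) (hC : C₀ < C₁)
    (𝓥 : Set (ℕ+ → ℝ)) (hb𝓥 : b ∈ 𝓥) (h𝓥 : 𝓥 ⊆ NoisyGSM.singularClass b C₀ C₁) :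
    (NoisyGSM.Comparable b (fun j => ((j : ℕ) : ℝ) ^ (-t)) →
      NoisyGSM.Comparable a (fun j => ((j : ℕ) : ℝ) ^ s) →
      NoisyGSM.GtrsimSmallNoise
        (fun ε σ => NoisyGSM.minimaxRadius a (NoisyGSM.singularClass b C₀ C₁) 𝓥 α β ε σ ^ 2)
        (fun ε σ => max (ε ^ (4 * s / (2 * s + 2 * t + 1 / 2))) (σ ^ (2 * min (s / t) 1)))) ∧
    (NoisyGSM.Comparable b (fun j => ((j : ℕ) : ℝ) ^ (-t)) →
      NoisyGSM.Comparable a (fun j => Real.exp (((j : ℕ) : ℝ) * s)) →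
      NoisyGSM.GtrsimSmallNoise
        (fun ε σ => NoisyGSM.minimaxRadius a (NoisyGSM.singularClass b C₀ C₁) 𝓥 α β ε σ ^ 2)
        (fun ε σ => max (ε ^ 2 * Real.log (1 / ε) ^ (2 * t + 1 / 2)) (σ ^ 2))) ∧
    (NoisyGSM.Comparable b (fun j => Real.exp (-(((j : ℕ) : ℝ) * t))) →
      NoisyGSM.Comparable a (fun j => ((j : ℕ) : ℝ) ^ s) →
      NoisyGSM.GtrsimSmallNoise
        (fun ε σ => NoisyGSM.minimaxRadius a (NoisyGSM.singularClass b C₀ C₁) 𝓥 α β ε σ ^ 2)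
        (fun ε σ => max (Real.log (1 / ε) ^ (-2 * s)) (Real.log (1 / σ) ^ (-2 * s)))) ∧
    (NoisyGSM.Comparable b (fun j => Real.exp (-(((j : ℕ) : ℝ) * t))) →
      NoisyGSM.Comparable a (fun j => Real.exp (((j : ℕ) : ℝ) * s)) →
      NoisyGSM.GtrsimSmallNoise
        (fun ε σ => NoisyGSM.minimaxRadius a (NoisyGSM.singularClass b C₀ C₁) 𝓥 α β ε σ ^ 2)
        (fun ε σ => max (ε ^ (2 * s / (s + t))) (σ ^ (2 * min (s / t) 1)))) := by
  have hA1 : 0 < (a 1 ^ 2)⁻¹ := by have := ha_pos 1; positivity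
  have hB1 : 0 < (b 1 ^ 2)⁻¹ := by have := hb_pos 1; positivity
  refine ⟨fun hb ha => ?_, fun hb ha => ?_, fun hb ha => ?_, fun hb ha => ?_⟩
  · obtain ⟨kA, hkA, hA⟩ := ha.exists_le_inv_sq_rpow ha_pos
    obtain ⟨kB, hkB, hB⟩ := hb.exists_le_inv_sq_rpow hb_pos
    simp only [mul_neg, neg_neg] at hB
    exact NoisyGSM.gtrsimSmallNoise_max hα hβ ha_pos ha_mono hb_pos hC₀' hC₁ hC hb𝓥
      (NoisyGSM.signPriorRate_of_poly_of_poly hs ht hkA hkB hA hB)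
      (NoisyGSM.unknownOperatorRate_min hA1 hB1
        (NoisyGSM.unknownOperatorRate_of_poly_of_poly hs ht hkA hkB hA hB))
  · obtain ⟨kA, hkA, hA⟩ := ha.exists_le_inv_sq_exp ha_pos
    obtain ⟨kB, hkB, hB⟩ := hb.exists_le_inv_sq_rpow hb_pos
    simp only [mul_neg, neg_neg] at hB
    exact NoisyGSM.gtrsimSmallNoise_max hα hβ ha_pos ha_mono hb_pos hC₀' hC₁ hC hb𝓥
      (NoisyGSM.signPriorRate_of_exp_of_poly hs ht hkA hkB hA hB)
      (NoisyGSM.unknownOperatorRate_sq hA1 hB1)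
  · obtain ⟨kA, hkA, hA⟩ := ha.exists_le_inv_sq_rpow ha_pos
    -- Rewriting the exponent as `j * (-t)` lets the exponential lemma apply with `x = -t`.
    simp only [← mul_neg] at hb
    obtain ⟨kB, hkB, hB⟩ := hb.exists_le_inv_sq_exp hb_pos
    simp only [mul_neg, neg_mul, neg_neg] at hB
    exact NoisyGSM.gtrsimSmallNoise_max hα hβ ha_pos ha_mono hb_pos hC₀' hC₁ hC hb𝓥
      (NoisyGSM.signPriorRate_of_poly_of_exp hs ht hkA hkB hA hB)
      (NoisyGSM.unknownOperatorRate_of_poly_of_exp hs ht hkA hkB hA hB)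
  · obtain ⟨kA, hkA, hA⟩ := ha.exists_le_inv_sq_exp ha_pos
    simp only [← mul_neg] at hb
    obtain ⟨kB, hkB, hB⟩ := hb.exists_le_inv_sq_exp hb_pos
    simp only [mul_neg, neg_mul, neg_neg] at hB
    exact NoisyGSM.gtrsimSmallNoise_max hα hβ ha_pos ha_mono hb_pos hC₀' hC₁ hC hb𝓥
      (NoisyGSM.signPriorRate_of_exp_of_exp hs ht hkA hkB hA hB)
      (NoisyGSM.unknownOperatorRate_min hA1 hB1
        (NoisyGSM.unknownOperatorRate_of_exp_of_exp hs ht hkA hkB hA hB))
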